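/- Let $v_0:\mathbb{R}^2\to\mathbb{R}$ be a bounded, measurable, radial function with $v_0\le 0$, $v_0\not\equiv 0$, and support in the disc $\{|x|\le a\}$, $a>0$. Let $d\in\mathbb{R}^2$ with $|d|>2a$, and put $V(x)=v_0(x)+v_0(x-d)$, $Ax=\tfrac12(x_2,-x_1)$, $P=-i\nabla$. For $\lambda>0$ consider on $L^2(\mathbb{R}^2)$ the self-adjoint operators $$h^\lambda=(P-\lambda Ax)^2+\lambda^2v_0,\qquad H^\lambda=(P-\lambda Ax)^2+\lambda^2V .$$ A ground state eigenpair of $h^\lambda$ is a pair $(e_0^\lambda,\varphi_0^\lambda)$ with $\|\varphi_0^\lambda\|=1$, $h^\lambda\varphi_0^\lambda=e_0^\lambda\varphi_0^\lambda$ and $h^\lambda\ge e_0^\lambda$. Assume that for all sufficiently large $\lambda$ every ground state $\varphi_0^\lambda$ is a radial function, and that there is $C_{\rm gap}>0$ such that for all sufficiently large $\lambda$, for every ground state eigenpair, $\langle\psi,(h^\lambda-e_0^\lambda)\psi\rangle\ge C_{\rm gap}\|\psi\|^2$ for all $\psi\in\mathrm{dom}(h^\lambda)$ with $\langle\varphi_0^\lambda,\psi\rangle=0$.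 Let $\varphi_d^\lambda(x)=e^{i\lambda x\cdot Ad}\varphi_0^\lambda(x-d)$, $\mathcal V=\mathrm{span}\{\varphi_0^\lambda,\varphi_d^\lambda\}$, and let $\Pi^\perp$ be the orthogonal projection onto $\mathcal V^\perp$. **Theorem B.1.** There are constants $\lambda_\star,C_1,C_2,r,K>0$, independent of $\lambda$, such that for all $\lambda>\lambda_\star$ and every ground state eigenpair $(e_0^\lambda,\varphi_0^\lambda)$ of $h^\lambda$: 1. For every $\psi$ in the domain of $H^\lambda$ (the magnetic Sobolev space of order two) with $\langle\varphi_0^\lambda,\psi\rangle=\langle\varphi_d^\lambda,\psi\rangle=0$, $$\langle\psi,(H^\lambda-e_0^\lambda)\psi\rangle\ \ge\ C_1\|\psi\|^2+C_2\lambda^{-2}\|(P-\lambda Ax)\psi\|^2 .$$ The same holds for every $\psi\in L^2$ with $(P-\lambda Ax)\psi\in L^2$ orthogonal to $\varphi_0^\lambda$ and $\varphi_d^\lambda$ (in particular for every such $\psi\in H^2(\mathbb{R}^2)$), if the left-hand side is read as the quadratic form $\|(P-\lambda Ax)\psi\|^2+\int(\lambda^2V-e_0^\lambda)|\psi|^2$.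 2. For every $z\in\mathbb{C}$ with $|z|<r$, the operator $\Pi^\perp(H^\lambda-e_0^\lambda-z)\Pi^\perp$ on $\mathcal V^\perp$, with domain $\mathrm{dom}(H^\lambda)\cap\mathcal V^\perp$, is bijective onto $\mathcal V^\perp$ with bounded inverse, and the norm of the inverse is at most $K$. -/

import Mathlib

open MeasureTheory Filter
open scoped ContDiff ComplexConjugate

namespace MagneticDoubleWell

noncomputable section

/-- The plane `ℝ²` with its Euclidean norm. -/
abbrev Plane : Type := EuclideanSpace ℝ (Fin 2)

/-- The Hilbert space `L²(ℝ²; ℂ)`. -/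
abbrev L2 : Type := Lp ℂ 2 (volume : Measure Plane)

/-- The Hilbert space `L²(ℝ²; ℂ²)` of square-integrable complex vector fields. -/
abbrev L2Vec : Type := PiLp 2 (fun _ : Fin 2 => L2)

/-- The vector potential `A x = (x₂, -x₁) / 2` of the constant magnetic field, symmetric gauge. -/
def vecPot (x : Plane) : Plane := !₂[x 1 / 2, -(x 0) / 2]

/-- The `j`-th component of `(P - b A x) η`, where `P = -i ∇`, for a differentiable `η`. -/
def magMomentum (b : ℝ) (j : Fin 2) (η : Plane → ℂ) (x : Plane) : ℂ :=
  -Complex.I * fderiv ℝ η x (EuclideanSpace.single j 1) - (b * vecPot x j : ℝ) * η x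

/-- `g = (P - b A x)_j ψ` in the sense of distributions. -/
def IsWeakMagMomentum (b : ℝ) (j : Fin 2) (ψ g : L2) : Prop :=
  ∀ η : Plane → ℂ, ContDiff ℝ ∞ η → HasCompactSupport η →
    ∫ x, conj (magMomentum b j η x) * ψ x = ∫ x, conj (η x) * g x

/-! ### Helper facts: integrability against test functions -/

lemma continuous_vecPot_apply (j : Fin 2) : Continuous fun x : Plane => vecPot x j := by
  fin_cases j <;> simp [vecPot] <;> fun_prop

lemma continuous_magMomentum (b : ℝ) (j : Fin 2) {η : Plane → ℂ} (hη : ContDiff ℝ ∞ η) :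
    Continuous (magMomentum b j η) := by
  have h1 : Continuous fun x => fderiv ℝ η x (EuclideanSpace.single j 1) :=
    (hη.continuous_fderiv (by simp)).clm_apply continuous_const
  have h2 := continuous_vecPot_apply j
  have h3 := hη.continuous
  unfold magMomentum
  fun_prop

lemma hasCompactSupport_magMomentum (b : ℝ) (j : Fin 2) {η : Plane → ℂ}
    (hc : HasCompactSupport η) : HasCompactSupport (magMomentum b j η) := by
  have h1 : HasCompactSupport fun x => fderiv ℝ η x (EuclideanSpace.single j 1) :=
    hc.fderiv_apply (𝕜 := ℝ) _
  have h2 : HasCompactSupport fun x => (-Complex.I) * fderiv ℝ η x (EuclideanSpace.single j 1) :=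
    h1.mul_left
  have h3 : HasCompactSupport fun x => ((b * vecPot x j : ℝ) : ℂ) * η x := hc.mul_left
  exact h2.sub h3

lemma integrable_conj_mul {u : Plane → ℂ} (hu : Continuous u) (hc : HasCompactSupport u) (ψ : L2) :
    Integrable fun x => conj (u x) * ψ x := by
  have h1 : MemLp (fun x => conj (u x)) 2 (volume : Measure Plane) :=
    (Complex.continuous_conj.comp hu).memLp_of_hasCompactSupport
      (hc.comp_left (g := fun z : ℂ => conj z) (map_zero _))
  exact h1.integrable_mul (Lp.memLp ψ)

lemma eq_zero_of_test {f : L2}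
    (h : ∀ η : Plane → ℂ, ContDiff ℝ ∞ η → HasCompactSupport η → ∫ x, conj (η x) * f x = 0) :
    f = 0 := by
  rw [Lp.eq_zero_iff_ae_eq_zero]
  refine ae_eq_zero_of_integral_contDiff_smul_eq_zero
    ((Lp.memLp f).locallyIntegrable (by norm_num)) ?_
  intro g hg hc
  have := h (fun x => (g x : ℂ)) (Complex.ofRealCLM.contDiff.comp hg)
    (hc.comp_left (g := fun r : ℝ => (r : ℂ)) (by simp))
  simpa using this

/-! ### The closed operator `P - b A x` -/

/-- The graph of the maximal operator `ψ ↦ (P - b A x) ψ` from `L²(ℝ²; ℂ)` to `L²(ℝ²; ℂ²)`. -/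
def magGradGraph (b : ℝ) : Submodule ℂ (L2 × L2Vec) where
  carrier := {p | ∀ j, IsWeakMagMomentum b j p.1 (p.2 j)}
  zero_mem' := by
    intro j η hη hc
    change ∫ x, conj (magMomentum b j η x) * (0 : L2) x = ∫ x, conj (η x) * (0 : L2) x
    have key : ∀ u : Plane → ℂ, ∫ x, conj (u x) * (0 : L2) x = 0 := by
      intro u
      rw [integral_congr_ae (g := fun _ => (0 : ℂ)), integral_zero]
      filter_upwards [Lp.coeFn_zero ℂ 2 (volume : Measure Plane)] with x hx
      rw [hx, Pi.zero_apply, mul_zero]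
    rw [key, key]
  add_mem' := by
    intro p q hp hq j η hη hc
    have key : ∀ (u : Plane → ℂ), Continuous u → HasCompactSupport u → ∀ f g : L2,
        ∫ x, conj (u x) * (f + g : L2) x = (∫ x, conj (u x) * f x) + ∫ x, conj (u x) * g x := by
      intro u hu hcu f g
      rw [← integral_add (integrable_conj_mul hu hcu f) (integrable_conj_mul hu hcu g)]
      refine integral_congr_ae ?_
      filter_upwards [Lp.coeFn_add f g] with x hx
      rw [hx, Pi.add_apply, mul_add]
    have e1 := key _ (continuous_magMomentum b j hη) (hasCompactSupport_magMomentum b j hc) p.1 q.1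
    have e2 := key _ hη.continuous hc (p.2 j) (q.2 j)
    change _ = ∫ x, conj (η x) * (p.2 j + q.2 j : L2) x
    rw [e2, ← hp j η hη hc, ← hq j η hη hc]
    exact e1
  smul_mem' := by
    intro c p hp j η hη hc
    have key : ∀ (u : Plane → ℂ) (f : L2),
        ∫ x, conj (u x) * (c • f : L2) x = c * ∫ x, conj (u x) * f x := by
      intro u f
      rw [← integral_const_mul]
      refine integral_congr_ae ?_
      filter_upwards [Lp.coeFn_smul c f] with x hx
      simp [hx, mul_left_comm]
    change ∫ x, conj (magMomentum b j η x) * (c • p.1 : L2) x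
      = ∫ x, conj (η x) * (c • p.2 j : L2) x
    rw [key, key, hp j η hη hc]

/-- The operator `ψ ↦ (P - b A x) ψ` from `L²(ℝ²; ℂ)` to `L²(ℝ²; ℂ²)`. Its domain is the magnetic
Sobolev space of all `ψ ∈ L²` with `(P - b A x) ψ ∈ L²`, which is the form domain of the
Hamiltonians below. -/
def magGrad (b : ℝ) : L2 →ₗ.[ℂ] L2Vec := (magGradGraph b).toLinearPMap

lemma magGradGraph_functional (b : ℝ) :
    ∀ p : L2 × L2Vec, p ∈ magGradGraph b → p.1 = 0 → p.2 = 0 := by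
  intro p hp h0
  ext1 j
  refine eq_zero_of_test fun η hη hc => ?_
  rw [← hp j η hη hc, h0]
  rw [integral_congr_ae (g := fun _ => (0 : ℂ)), integral_zero]
  filter_upwards [Lp.coeFn_zero ℂ 2 (volume : Measure Plane)] with x hx
  rw [hx, Pi.zero_apply, mul_zero]

lemma magGrad_graph (b : ℝ) : (magGrad b).graph = magGradGraph b :=
  Submodule.toLinearPMap_graph_eq _ fun p hp h => magGradGraph_functional b p hp h

/-- Test functions lie in the domain of `magGrad b`. -/
lemma test_mem_domain (b : ℝ) {η : Plane → ℂ} (hη : ContDiff ℝ ∞ η) (hc : HasCompactSupport η) :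
    (hη.continuous.memLp_of_hasCompactSupport (μ := volume) (p := 2) hc).toLp η
      ∈ (magGrad b).domain := by
  have hm : ∀ j, MemLp (magMomentum b j η) 2 (volume : Measure Plane) := fun j =>
    (continuous_magMomentum b j hη).memLp_of_hasCompactSupport (hasCompactSupport_magMomentum b j hc)
  refine Submodule.mem_map.2 ⟨(_, WithLp.toLp 2 fun j => (hm j).toLp _), ?_, rfl⟩
  intro j θ hθ hcθ
  have hM := (hη.continuous.memLp_of_hasCompactSupport (μ := volume) (p := 2) hc)
  set v : Plane := EuclideanSpace.single j 1 with hv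
  have l1 : ∫ x, conj (magMomentum b j θ x) * (hM.toLp η) x
      = ∫ x, conj (magMomentum b j θ x) * η x := by
    refine integral_congr_ae ?_
    filter_upwards [hM.coeFn_toLp] with x hx
    rw [hx]
  have l2 : ∫ x, conj (θ x) * ((hm j).toLp _ : L2) x
      = ∫ x, conj (θ x) * magMomentum b j η x := by
    refine integral_congr_ae ?_
    filter_upwards [(hm j).coeFn_toLp] with x hx
    rw [hx]
  refine Eq.trans l1 (Eq.trans ?_ l2.symm)
  have hθ' : ContDiff ℝ ∞ fun x => conj (θ x) := Complex.conjCLE.contDiff.comp hθ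
  have hcθ' : HasCompactSupport fun x => conj (θ x) :=
    hcθ.comp_left (g := fun z : ℂ => conj z) (map_zero _)
  have hd : ∀ x, fderiv ℝ (fun x => conj (θ x)) x v = conj (fderiv ℝ θ x v) := by
    intro x
    have h := (Complex.conjCLE.toContinuousLinearMap.hasFDerivAt.comp x
      (hθ.differentiable (by simp) x).hasFDerivAt).fderiv
    have h' := congrArg (fun L : Plane →L[ℝ] ℂ => L v) h
    simpa [Function.comp_def] using h'
  have cA : Continuous fun x => fderiv ℝ (fun x => conj (θ x)) x v :=
    (hθ'.continuous_fderiv (by simp)).clm_apply continuous_const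
  have cB : Continuous fun x => fderiv ℝ η x v :=
    (hη.continuous_fderiv (by simp)).clm_apply continuous_const
  have cP := continuous_vecPot_apply j
  have iA : Integrable fun x => fderiv ℝ (fun x => conj (θ x)) x v * η x :=
    (cA.mul hη.continuous).integrable_of_hasCompactSupport hc.mul_left
  have iB : Integrable fun x => conj (θ x) * fderiv ℝ η x v :=
    (hθ'.continuous.mul cB).integrable_of_hasCompactSupport hcθ'.mul_right
  have iC : Integrable fun x => conj (θ x) * η x :=
    (hθ'.continuous.mul hη.continuous).integrable_of_hasCompactSupport hc.mul_left
  have iD : Integrable fun x => ((b * vecPot x j : ℝ) : ℂ) * (conj (θ x) * η x) := by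
    have hcD : HasCompactSupport fun x => ((b * vecPot x j : ℝ) : ℂ) * (conj (θ x) * η x) :=
      HasCompactSupport.mul_left (f := fun x => ((b * vecPot x j : ℝ) : ℂ))
        (f' := fun x => conj (θ x) * η x) hc.mul_left
    refine Continuous.integrable_of_hasCompactSupport ?_ hcD
    have := hθ'.continuous
    have := hη.continuous
    fun_prop
  have ibp := integral_mul_fderiv_eq_neg_fderiv_mul_of_integrable (μ := volume) iA iB iC
    (fun x _ => hθ'.differentiable (by simp) x) (fun x _ => hη.differentiable (by simp) x)
  have lhs : (fun x => conj (magMomentum b j θ x) * η x) = fun x =>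
      Complex.I * (fderiv ℝ (fun x => conj (θ x)) x v * η x)
        - ((b * vecPot x j : ℝ) : ℂ) * (conj (θ x) * η x) := by
    funext x
    rw [hd]
    simp only [magMomentum, map_sub, map_mul, map_neg, Complex.conj_I, Complex.conj_ofReal, ← hv]
    ring
  have rhs : (fun x => conj (θ x) * magMomentum b j η x) = fun x =>
      -Complex.I * (conj (θ x) * fderiv ℝ η x v)
        - ((b * vecPot x j : ℝ) : ℂ) * (conj (θ x) * η x) := by
    funext x
    simp only [magMomentum, ← hv]
    ring
  rw [lhs, rhs, integral_sub (iA.const_mul _) iD, integral_sub (iB.const_mul _) iD,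
    integral_const_mul, integral_const_mul, ibp]
  ring

/-! ### The self-adjoint operators `(P - b A x)²` and `(P - b A x)² + W` -/

/-- The graph of `(P - b A x)² = (P - b A x)^* (P - b A x)`. -/
def landauGraph (b : ℝ) : Submodule ℂ (L2 × L2) where
  carrier := {p | ∃ h : p.1 ∈ (magGrad b).domain, ∀ φ : (magGrad b).domain,
    inner ℂ (magGrad b φ) (magGrad b ⟨p.1, h⟩) = inner ℂ (φ : L2) p.2}
  zero_mem' := by
    refine ⟨Submodule.zero_mem _, fun φ => ?_⟩
    have h0 : magGrad b ⟨0, Submodule.zero_mem _⟩ = 0 := (magGrad b).map_zero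
    change inner ℂ (magGrad b φ) (magGrad b ⟨0, Submodule.zero_mem _⟩) = inner ℂ (φ : L2) 0
    rw [h0, inner_zero_right, inner_zero_right]
  add_mem' := by
    rintro p q ⟨hp, hp'⟩ ⟨hq, hq'⟩
    refine ⟨Submodule.add_mem _ hp hq, fun φ => ?_⟩
    have h0 : magGrad b ⟨p.1 + q.1, Submodule.add_mem _ hp hq⟩
        = magGrad b ⟨p.1, hp⟩ + magGrad b ⟨q.1, hq⟩ :=
      (magGrad b).map_add ⟨p.1, hp⟩ ⟨q.1, hq⟩
    change inner ℂ (magGrad b φ) (magGrad b ⟨p.1 + q.1, _⟩) = inner ℂ (φ : L2) (p.2 + q.2)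
    rw [h0, inner_add_right, inner_add_right, hp', hq']
  smul_mem' := by
    rintro c p ⟨hp, hp'⟩
    refine ⟨Submodule.smul_mem _ c hp, fun φ => ?_⟩
    have h0 : magGrad b ⟨c • p.1, Submodule.smul_mem _ c hp⟩ = c • magGrad b ⟨p.1, hp⟩ :=
      (magGrad b).map_smul c ⟨p.1, hp⟩
    change inner ℂ (magGrad b φ) (magGrad b ⟨c • p.1, _⟩) = inner ℂ (φ : L2) (c • p.2)
    rw [h0, inner_smul_right, inner_smul_right, hp']

/-- The Landau Hamiltonian `(P - b A x)²` as a self-adjoint operator: `ψ` is in its domain, with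
image `f`, if `(P - b A x) ψ ∈ L²` and `⟨(P - b A x) φ, (P - b A x) ψ⟩ = ⟨φ, f⟩` for every `φ` in
the form domain. -/
def landau (b : ℝ) : L2 →ₗ.[ℂ] L2 := (landauGraph b).toLinearPMap

lemma landauGraph_functional (b : ℝ) :
    ∀ p : L2 × L2, p ∈ landauGraph b → p.1 = 0 → p.2 = 0 := by
  rintro ⟨ψ, f⟩ ⟨h, h'⟩ h0
  obtain rfl : ψ = 0 := h0
  refine eq_zero_of_test fun η hη hc => ?_
  have hM := (hη.continuous.memLp_of_hasCompactSupport (μ := volume) (p := 2) hc)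
  have h1 := h' ⟨_, test_mem_domain b hη hc⟩
  have h2 : magGrad b ⟨(0 : L2), h⟩ = 0 := (magGrad b).map_zero
  rw [h2, inner_zero_right, L2.inner_def] at h1
  change ∫ x, conj (η x) * f x = 0
  rw [h1]
  refine integral_congr_ae ?_
  filter_upwards [hM.coeFn_toLp] with x hx
  simp [hx, mul_comm]

lemma landau_graph (b : ℝ) : (landau b).graph = landauGraph b :=
  Submodule.toLinearPMap_graph_eq _ fun p hp h => landauGraph_functional b p hp h

/-- The graph of `(P - b A x)² + W`. -/
def schrodingerGraph (b : ℝ) (W : Plane → ℝ) : Submodule ℂ (L2 × L2) where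
  carrier := {p | ∃ h : p.1 ∈ (landau b).domain,
    (p.2 : Plane → ℂ) =ᵐ[volume] fun x => (landau b ⟨p.1, h⟩ : L2) x + (W x : ℂ) * (p.1 : L2) x}
  zero_mem' := by
    refine ⟨Submodule.zero_mem _, ?_⟩
    have h0 : landau b ⟨0, Submodule.zero_mem _⟩ = 0 := (landau b).map_zero
    change ((0 : L2) : Plane → ℂ) =ᵐ[volume] fun x =>
      (landau b ⟨0, Submodule.zero_mem _⟩ : L2) x + (W x : ℂ) * (0 : L2) x
    rw [h0]
    filter_upwards [Lp.coeFn_zero ℂ 2 (volume : Measure Plane)] with x hx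
    rw [hx, Pi.zero_apply, mul_zero, add_zero]
  add_mem' := by
    rintro p q ⟨hp, hp'⟩ ⟨hq, hq'⟩
    refine ⟨Submodule.add_mem _ hp hq, ?_⟩
    have h0 : landau b ⟨p.1 + q.1, Submodule.add_mem _ hp hq⟩
        = landau b ⟨p.1, hp⟩ + landau b ⟨q.1, hq⟩ :=
      (landau b).map_add ⟨p.1, hp⟩ ⟨q.1, hq⟩
    change ((p.2 + q.2 : L2) : Plane → ℂ) =ᵐ[volume] fun x =>
      (landau b ⟨p.1 + q.1, Submodule.add_mem _ hp hq⟩ : L2) x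
        + (W x : ℂ) * (p.1 + q.1 : L2) x
    rw [h0]
    filter_upwards [hp', hq', Lp.coeFn_add p.2 q.2, Lp.coeFn_add p.1 q.1,
      Lp.coeFn_add (landau b ⟨p.1, hp⟩) (landau b ⟨q.1, hq⟩)] with x h1 h2 h3 h4 h5
    rw [h3, h4, h5, Pi.add_apply, Pi.add_apply, Pi.add_apply, h1, h2]
    ring
  smul_mem' := by
    rintro c p ⟨hp, hp'⟩
    refine ⟨Submodule.smul_mem _ c hp, ?_⟩
    have h0 : landau b ⟨c • p.1, Submodule.smul_mem _ c hp⟩ = c • landau b ⟨p.1, hp⟩ :=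
      (landau b).map_smul c ⟨p.1, hp⟩
    change ((c • p.2 : L2) : Plane → ℂ) =ᵐ[volume] fun x =>
      (landau b ⟨c • p.1, Submodule.smul_mem _ c hp⟩ : L2) x + (W x : ℂ) * (c • p.1 : L2) x
    rw [h0]
    filter_upwards [hp', Lp.coeFn_smul c p.2, Lp.coeFn_smul c p.1,
      Lp.coeFn_smul c (landau b ⟨p.1, hp⟩)] with x h1 h3 h4 h5
    rw [h3, h4, h5, Pi.smul_apply, Pi.smul_apply, Pi.smul_apply, h1]
    simp only [smul_eq_mul]
    ring

/-- The magnetic Schrödinger operator `(P - b A x)² + W` on `L²(ℝ²; ℂ)`; for bounded `W` its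
domain is that of `(P - b A x)²`. -/
def schrodinger (b : ℝ) (W : Plane → ℝ) : L2 →ₗ.[ℂ] L2 := (schrodingerGraph b W).toLinearPMap

lemma schrodingerGraph_functional (b : ℝ) (W : Plane → ℝ) :
    ∀ p : L2 × L2, p ∈ schrodingerGraph b W → p.1 = 0 → p.2 = 0 := by
  rintro ⟨ψ, f⟩ ⟨h, h'⟩ h0
  obtain rfl : ψ = 0 := h0
  have h2 : landau b ⟨(0 : L2), h⟩ = 0 := (landau b).map_zero
  change (f : Plane → ℂ) =ᵐ[volume] fun x =>
    (landau b ⟨(0 : L2), h⟩ : L2) x + (W x : ℂ) * (0 : L2) x at h'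
  rw [h2] at h'
  change f = 0
  rw [Lp.eq_zero_iff_ae_eq_zero]
  filter_upwards [h', Lp.coeFn_zero ℂ 2 (volume : Measure Plane)] with x h1 h3
  rw [h1, h3, Pi.zero_apply, mul_zero, add_zero]

lemma schrodinger_graph (b : ℝ) (W : Plane → ℝ) :
    (schrodinger b W).graph = schrodingerGraph b W :=
  Submodule.toLinearPMap_graph_eq _ fun p hp h => schrodingerGraph_functional b W p hp h

lemma schrodinger_domain_le (b : ℝ) (W : Plane → ℝ) :
    (schrodinger b W).domain ≤ (magGrad b).domain := by
  rintro ψ ⟨⟨ψ', f⟩, ⟨hl, -⟩, rfl⟩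
  obtain ⟨⟨ψ'', k⟩, ⟨hg, -⟩, e⟩ := hl
  have e' : ψ'' = ψ' := e
  subst e'
  exact hg

/-! ### Single well, double well, ground states -/

/-- The single-well Hamiltonian `h^λ = (P - λ A x)² + λ² v₀`. -/
def singleWell (v : Plane → ℝ) (lam : ℝ) : L2 →ₗ.[ℂ] L2 :=
  schrodinger lam fun x => lam ^ 2 * v x

/-- The double-well Hamiltonian `H^λ = (P - λ A x)² + λ² V`, `V x = v₀ x + v₀ (x - d)`. -/
def doubleWell (v : Plane → ℝ) (d : Plane) (lam : ℝ) : L2 →ₗ.[ℂ] L2 :=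
  schrodinger lam fun x => lam ^ 2 * (v x + v (x - d))

/-- The operator `T - w`, with the domain of `T`. -/
def shift (T : L2 →ₗ.[ℂ] L2) (w : ℂ) : L2 →ₗ.[ℂ] L2 where
  domain := T.domain
  toFun := T.toFun - w • T.domain.subtype

/-- `(φ, e)` is a normalized ground state eigenpair of the symmetric operator `T`. -/
def IsGroundState (T : L2 →ₗ.[ℂ] L2) (e : ℝ) (φ : L2) : Prop :=
  ‖φ‖ = 1 ∧ (∃ h : φ ∈ T.domain, T ⟨φ, h⟩ = (e : ℂ) • φ) ∧
    ∀ ψ : T.domain, e * ‖ψ‖ ^ 2 ≤ (inner ℂ (ψ : L2) (T ψ)).re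

/-- `φ` is (almost everywhere) a function of `|x|` only. -/
def IsRadial (φ : L2) : Prop :=
  ∃ u : ℝ → ℂ, (φ : Plane → ℂ) =ᵐ[volume] fun x => u ‖x‖

/-- The standing assumptions on the atomic well `v₀`. -/
structure IsAtomicWell (v : Plane → ℝ) (a : ℝ) : Prop where
  radius_pos : 0 < a
  measurable : Measurable v
  nonpos : ∀ x, v x ≤ 0
  bounded : ∃ M : ℝ, ∀ x, -M ≤ v x
  neg : ∃ x, v x < 0
  radial : ∀ x y, ‖x‖ = ‖y‖ → v x = v y
  support : tsupport v ⊆ Metric.closedBall 0 a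
  /-- For large `λ` the ground state of `h^λ` is radial. -/
  radial_groundState : ∀ᶠ lam : ℝ in atTop, ∀ (e : ℝ) (φ : L2),
    IsGroundState (singleWell v lam) e φ → IsRadial φ
  /-- For large `λ` the spectral gap of `h^λ` above its ground state energy is at least of
  order one. -/
  gap : ∃ c : ℝ, 0 < c ∧ ∀ᶠ lam : ℝ in atTop, ∀ (e : ℝ) (φ : L2),
    IsGroundState (singleWell v lam) e φ →
      ∀ ψ : (singleWell v lam).domain, inner ℂ φ (ψ : L2) = 0 →
        c * ‖ψ‖ ^ 2 ≤ (inner ℂ (ψ : L2) (shift (singleWell v lam) e ψ)).re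

/-! ### Magnetic translations and the orbital subspace -/

lemma memLp_magTranslate (b : ℝ) (z : Plane) (φ : L2) :
    MemLp (fun x : Plane => Complex.exp (Complex.I * (b * inner ℝ x (vecPot z) : ℝ)) * φ (x - z))
      2 volume := by
  have h1 : MemLp (fun x : Plane => φ (x - z)) 2 volume :=
    (Lp.memLp φ).comp_measurePreserving (measurePreserving_sub_right volume z)
  refine MemLp.of_le h1 ?_ (Eventually.of_forall fun x => ?_)
  · refine AEStronglyMeasurable.mul ?_ h1.1
    exact Continuous.aestronglyMeasurable (by fun_prop)
  · rw [norm_mul, mul_comm Complex.I, Complex.norm_exp_ofReal_mul_I, one_mul]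

/-- The magnetic translation `(R̂^z φ)(x) = exp(i x · b A z) φ(x - z)`. -/
def magTranslate (b : ℝ) (z : Plane) (φ : L2) : L2 := (memLp_magTranslate b z φ).toLp _

/-- The magnetic orbital subspace spanned by `φ` and its magnetic translate to `d`. -/
def orbitalSpace (lam : ℝ) (d : Plane) (φ : L2) : Submodule ℂ L2 :=
  Submodule.span ℂ {φ, magTranslate lam d φ}

/-- The compression `Π T Π` of `T` to the closed subspace `K`, as an operator in `K`, where `Π` is
the orthogonal projection onto `K`; its domain is the part of the domain of `T` in `K`. -/
def compression (T : L2 →ₗ.[ℂ] L2) (K : Submodule ℂ L2) [K.HasOrthogonalProjection] :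
    K →ₗ.[ℂ] K where
  domain := T.domain.comap K.subtype
  toFun := (K.orthogonalProjectionOnto : L2 →ₗ[ℂ] K) ∘ₗ T.toFun ∘ₗ
    (K.subtype.restrict (p := T.domain.comap K.subtype) (q := T.domain) fun _ h => h)

/-- The bounded operator `R` is a two-sided inverse of the (unbounded) operator `T`. -/
def IsBoundedInverse {K : Submodule ℂ L2} (T : K →ₗ.[ℂ] K) (R : K →L[ℂ] K) : Prop :=
  (∀ f : K, ∃ h : R f ∈ T.domain, T ⟨R f, h⟩ = f) ∧ ∀ ψ : T.domain, R (T ψ) = ψ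

end

end MagneticDoubleWell

namespace MagneticDoubleWell

noncomputable section

/-! ### Membership in the graphs -/

/-! Everything rests on a coercivity bound for the quadratic form of `H^λ - e` on the form domain.
The gap and the localization errors are of order one, while for large `λ` the wells are of depth
`λ²`. Thus `e ≤ -c'λ²` (`exists_energy_le`, by a translated trial bump), and any part of a state
lying outside the wells costs at least `-e`, which is as large as desired.

The form is cut by two smooth quadratic partitions of unity, around `0` and around `d`, supported in
disjoint discs. On the piece near one well only that well is seen, so the one-well gap applies, up
to the overlap of the piece with the orbital. This overlap is at most the tail of the orbital
outside its well, and the tail has squared norm `O(1/|e|)` by energy comparison alone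
(`IsGappedState.tail_le`); no exponential decay is needed. The localization errors do not become
small, but they vanish wherever the outer cutoff does. They are therefore at most `c/8` plus a
multiple of the squared outer cutoff (`exists_gradSq_le`), and that multiple is paid for by the cost
`-e` of the outer piece. This is `energy_ge_of_two_wells`, with constant `c/2`. Mixing in a small
multiple of the trivial bound `‖(P - λA)ψ‖² - 2Mλ²‖ψ‖²` yields the kinetic term.

Since `v` is only assumed nonzero at a point, it may vanish almost everywhere. Then a gapped ground
state cannot exist, because its magnetic translates have the same energy and are not all parallel to
it.

The gap is assumed on the operator domain; it passes to the form domain because the former is a core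
(`HasMagGrad.mem_closure`). For the resolvent, the same coercivity gives the lower bound on the
compressed operator and, through Lax–Milgram on `Vᗮ`, weak solutions. These lie in the operator
domain because the orbitals do (`compression_surjective`). -/

/-- `(P - b A x) ψ = g` in the sense of distributions. -/
def HasMagGrad (b : ℝ) (ψ : L2) (g : L2Vec) : Prop := ∀ j, IsWeakMagMomentum b j ψ (g j)

lemma hasMagGrad_magGrad (b : ℝ) (ψ : (magGrad b).domain) : HasMagGrad b ψ (magGrad b ψ) := by
  have h := (magGrad b).mem_graph ψ
  rw [magGrad_graph] at h
  exact h

lemma HasMagGrad.exists_magGrad_eq {b : ℝ} {ψ : L2} {g : L2Vec} (h : HasMagGrad b ψ g) :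
    ∃ hψ : ψ ∈ (magGrad b).domain, magGrad b ⟨ψ, hψ⟩ = g := by
  have h' : (ψ, g) ∈ (magGrad b).graph := by
    rw [magGrad_graph]; exact h
  obtain ⟨y, hy, hy'⟩ := (LinearPMap.mem_graph_iff _).1 h'
  refine ⟨(show (y : L2) = ψ from hy) ▸ y.2, ?_⟩
  refine Eq.trans ?_ hy'
  congr 1
  exact Subtype.ext hy.symm

lemma HasMagGrad.mem_domain {b : ℝ} {ψ : L2} {g : L2Vec} (h : HasMagGrad b ψ g) :
    ψ ∈ (magGrad b).domain := h.exists_magGrad_eq.1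

lemma HasMagGrad.magGrad_eq {b : ℝ} {ψ : L2} {g : L2Vec} (h : HasMagGrad b ψ g)
    (hψ : ψ ∈ (magGrad b).domain) : magGrad b ⟨ψ, hψ⟩ = g := h.exists_magGrad_eq.2

lemma HasMagGrad.add {b : ℝ} {ψ ψ' : L2} {g g' : L2Vec} (h : HasMagGrad b ψ g)
    (h' : HasMagGrad b ψ' g') : HasMagGrad b (ψ + ψ') (g + g') :=
  (magGradGraph b).add_mem (x := (ψ, g)) (y := (ψ', g')) h h'

lemma HasMagGrad.smul {b : ℝ} {ψ : L2} {g : L2Vec} (h : HasMagGrad b ψ g) (c : ℂ) :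
    HasMagGrad b (c • ψ) (c • g) :=
  (magGradGraph b).smul_mem (x := (ψ, g)) c h

lemma HasMagGrad.unique {b : ℝ} {ψ : L2} {g g' : L2Vec} (h : HasMagGrad b ψ g)
    (h' : HasMagGrad b ψ g') : g = g' := by
  rw [← h.magGrad_eq h.mem_domain, h'.magGrad_eq]

/-- `(P - b A x)² ψ = f`. -/
def HasLandau (b : ℝ) (ψ f : L2) : Prop :=
  ∃ g, HasMagGrad b ψ g ∧ ∀ u gu, HasMagGrad b u gu → inner ℂ gu g = inner ℂ u f

lemma hasLandau_iff {b : ℝ} {ψ f : L2} : HasLandau b ψ f ↔ (ψ, f) ∈ landauGraph b := by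
  constructor
  · rintro ⟨g, hg, h⟩
    refine ⟨hg.mem_domain, fun φ => ?_⟩
    rw [hg.magGrad_eq]
    exact h _ _ (hasMagGrad_magGrad b φ)
  · rintro ⟨hψ, h⟩
    refine ⟨_, hasMagGrad_magGrad b ⟨ψ, hψ⟩, fun u gu hu => ?_⟩
    have := h ⟨u, hu.mem_domain⟩
    rwa [hu.magGrad_eq] at this

lemma hasLandau_landau (b : ℝ) (ψ : (landau b).domain) : HasLandau b ψ (landau b ψ) := by
  have h := (landau b).mem_graph ψ
  rw [landau_graph] at h
  exact hasLandau_iff.2 h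

lemma HasLandau.exists_landau_eq {b : ℝ} {ψ f : L2} (h : HasLandau b ψ f) :
    ∃ hψ : ψ ∈ (landau b).domain, landau b ⟨ψ, hψ⟩ = f := by
  have h' : (ψ, f) ∈ (landau b).graph := by
    rw [landau_graph]; exact hasLandau_iff.1 h
  obtain ⟨y, hy, hy'⟩ := (LinearPMap.mem_graph_iff _).1 h'
  refine ⟨(show (y : L2) = ψ from hy) ▸ y.2, ?_⟩
  refine Eq.trans ?_ hy'
  congr 1
  exact Subtype.ext hy.symm

lemma HasLandau.add {b : ℝ} {ψ ψ' f f' : L2} (h : HasLandau b ψ f)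
    (h' : HasLandau b ψ' f') : HasLandau b (ψ + ψ') (f + f') :=
  hasLandau_iff.2 ((landauGraph b).add_mem (x := (ψ, f)) (y := (ψ', f'))
    (hasLandau_iff.1 h) (hasLandau_iff.1 h'))

lemma HasLandau.smul {b : ℝ} {ψ f : L2} (h : HasLandau b ψ f) (c : ℂ) :
    HasLandau b (c • ψ) (c • f) :=
  hasLandau_iff.2 ((landauGraph b).smul_mem (x := (ψ, f)) c (hasLandau_iff.1 h))

lemma HasLandau.inner_eq {b : ℝ} {ψ f u : L2} {g gu : L2Vec} (h : HasLandau b ψ f)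
    (hg : HasMagGrad b ψ g) (hu : HasMagGrad b u gu) : inner ℂ gu g = inner ℂ u f := by
  obtain ⟨g', hg', h'⟩ := h
  rw [hg.unique hg']
  exact h' u gu hu

/-! ### Multiplication operators -/

/-- `χ` is measurable and bounded. -/
structure IsBddMeas {E : Type*} [NormedAddCommGroup E] [MeasurableSpace E] (χ : Plane → E) :
    Prop where
  measurable : Measurable χ
  bounded : ∃ C, ∀ x, ‖χ x‖ ≤ C

lemma IsBddMeas.memLp_mul {χ : Plane → ℂ} (h : IsBddMeas χ) (f : L2) :
    MemLp (fun x => χ x * f x) 2 volume := by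
  obtain ⟨C, hC⟩ := h.bounded
  refine MemLp.of_le_mul (Lp.memLp f) (h.measurable.aestronglyMeasurable.mul (Lp.memLp f).1)
    (c := C) (Eventually.of_forall fun x => ?_)
  rw [norm_mul]
  exact mul_le_mul_of_nonneg_right (hC x) (norm_nonneg _)

lemma norm_sq_eq_integral (f : L2) : ‖f‖ ^ 2 = ∫ x, ‖f x‖ ^ 2 := by
  have h : ‖f‖ ^ 2 = (inner ℂ f f).re := by
    rw [inner_self_eq_norm_sq_to_K]; norm_cast
  rw [h, L2.inner_def]
  have h2 : (fun x => inner ℂ (f x) (f x)) = fun x => ((‖f x‖ ^ 2 : ℝ) : ℂ) := by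
    funext x
    rw [inner_self_eq_norm_sq_to_K]; norm_cast
  rw [h2, integral_complex_ofReal, Complex.ofReal_re]

lemma integrable_norm_sq (f : L2) : Integrable (fun x => ‖f x‖ ^ 2) :=
  (memLp_two_iff_integrable_sq_norm (Lp.memLp f).1).1 (Lp.memLp f)

/-- Multiplication by a bounded measurable function, as a bounded operator on `L²`. -/
def mulOp (χ : Plane → ℂ) (h : IsBddMeas χ) : L2 →L[ℂ] L2 :=
  LinearMap.mkContinuousOfExistsBound
    { toFun := fun f => (h.memLp_mul f).toLp _
      map_add' := fun f g => by
        ext1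
        filter_upwards [(h.memLp_mul (f + g)).coeFn_toLp, (h.memLp_mul f).coeFn_toLp,
          (h.memLp_mul g).coeFn_toLp, Lp.coeFn_add f g,
          Lp.coeFn_add ((h.memLp_mul f).toLp _) ((h.memLp_mul g).toLp _)] with x h1 h2 h3 h4 h5
        rw [h1, h5, h4, Pi.add_apply, Pi.add_apply, h2, h3, mul_add]
      map_smul' := fun c f => by
        ext1
        filter_upwards [(h.memLp_mul (c • f)).coeFn_toLp, (h.memLp_mul f).coeFn_toLp,
          Lp.coeFn_smul c f, Lp.coeFn_smul c ((h.memLp_mul f).toLp _)] with x h1 h2 h4 h5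
        rw [h1, RingHom.id_apply, h5, h4, Pi.smul_apply, Pi.smul_apply, h2, smul_eq_mul,
          smul_eq_mul, mul_left_comm] }
    (by
      obtain ⟨C, hC⟩ := h.bounded
      refine ⟨C, fun f => ?_⟩
      refine Lp.norm_le_mul_norm_of_ae_le_mul ?_
      filter_upwards [(h.memLp_mul f).coeFn_toLp] with x hx
      change ‖((h.memLp_mul f).toLp _ : L2) x‖ ≤ _
      rw [hx, norm_mul]
      exact mul_le_mul_of_nonneg_right (hC x) (norm_nonneg _))

lemma coeFn_mulOp {χ : Plane → ℂ} (h : IsBddMeas χ) (f : L2) :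
    (mulOp χ h f : Plane → ℂ) =ᵐ[volume] fun x => χ x * f x :=
  (h.memLp_mul f).coeFn_toLp

lemma IsBddMeas.ofReal {w : Plane → ℝ} (h : IsBddMeas w) : IsBddMeas fun x => (w x : ℂ) :=
  ⟨Complex.measurable_ofReal.comp h.measurable, by
    obtain ⟨C, hC⟩ := h.bounded
    exact ⟨C, fun x => by simpa using hC x⟩⟩

lemma IsBddMeas.integrable_mul_norm_sq {w : Plane → ℝ} (h : IsBddMeas w) (f : L2) :
    Integrable fun x => w x * ‖f x‖ ^ 2 := by
  obtain ⟨C, hC⟩ := h.bounded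
  exact (integrable_norm_sq f).bdd_mul (c := C) h.measurable.aestronglyMeasurable
    (Eventually.of_forall hC)

/-- Multiplication by a bounded real function. -/
def rmul (w : Plane → ℝ) (h : IsBddMeas w) : L2 →L[ℂ] L2 := mulOp (fun x => (w x : ℂ)) h.ofReal

lemma coeFn_rmul {w : Plane → ℝ} (h : IsBddMeas w) (f : L2) :
    (rmul w h f : Plane → ℂ) =ᵐ[volume] fun x => (w x : ℂ) * f x :=
  coeFn_mulOp h.ofReal f

lemma norm_sq_rmul {w : Plane → ℝ} (h : IsBddMeas w) (f : L2) :
    ‖rmul w h f‖ ^ 2 = ∫ x, w x ^ 2 * ‖f x‖ ^ 2 := by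
  rw [norm_sq_eq_integral]
  refine integral_congr_ae ?_
  filter_upwards [coeFn_rmul h f] with x hx
  rw [hx, norm_mul, Complex.norm_real, mul_pow, Real.norm_eq_abs, sq_abs]

lemma inner_rmul_right {w : Plane → ℝ} (h : IsBddMeas w) (f g : L2) :
    inner ℂ f (rmul w h g) = inner ℂ (rmul w h f) g := by
  rw [L2.inner_def, L2.inner_def]
  refine integral_congr_ae ?_
  filter_upwards [coeFn_rmul h f, coeFn_rmul h g] with x h1 h2
  rw [h1, h2]
  simp
  ring

lemma inner_rmul_self {w : Plane → ℝ} (h : IsBddMeas w) (f : L2) :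
    inner ℂ f (rmul w h f) = ((∫ x, w x * ‖f x‖ ^ 2 : ℝ) : ℂ) := by
  rw [L2.inner_def, ← integral_complex_ofReal]
  refine integral_congr_ae ?_
  filter_upwards [coeFn_rmul h f] with x h1
  rw [h1]
  simp only [RCLike.inner_apply, Complex.ofReal_mul, Complex.ofReal_pow]
  rw [← Complex.mul_conj']
  ring

/-! ### The Schrödinger operator with a bounded potential -/

lemma schrodinger_apply {b : ℝ} {W : Plane → ℝ} (hW : IsBddMeas W) (ψ : (schrodinger b W).domain) :
    ∃ f, HasLandau b ψ f ∧ schrodinger b W ψ = f + rmul W hW ψ := by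
  have h := (schrodinger b W).mem_graph ψ
  rw [schrodinger_graph] at h
  obtain ⟨hl, he⟩ := h
  refine ⟨landau b ⟨ψ, hl⟩, hasLandau_landau b ⟨ψ, hl⟩, ?_⟩
  ext1
  filter_upwards [he, coeFn_rmul hW (ψ : L2),
    Lp.coeFn_add (landau b ⟨ψ, hl⟩) (rmul W hW ψ)] with x h1 h2 h3
  rw [h3, Pi.add_apply, h2]
  exact h1

lemma HasLandau.exists_schrodinger_eq {b : ℝ} {W : Plane → ℝ} (hW : IsBddMeas W) {ψ f : L2}
    (h : HasLandau b ψ f) :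
    ∃ hψ : ψ ∈ (schrodinger b W).domain, schrodinger b W ⟨ψ, hψ⟩ = f + rmul W hW ψ := by
  obtain ⟨hl, he⟩ := h.exists_landau_eq
  have h' : (ψ, f + rmul W hW ψ) ∈ (schrodinger b W).graph := by
    rw [schrodinger_graph]
    refine ⟨hl, ?_⟩
    filter_upwards [coeFn_rmul hW (ψ : L2), Lp.coeFn_add f (rmul W hW ψ)] with x h2 h3
    change (f + rmul W hW ψ : L2) x = (landau b ⟨ψ, hl⟩ : L2) x + _
    rw [he, h3, Pi.add_apply, h2]
  obtain ⟨y, hy, hy'⟩ := (LinearPMap.mem_graph_iff _).1 h'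
  refine ⟨(show (y : L2) = ψ from hy) ▸ y.2, ?_⟩
  refine Eq.trans ?_ hy'
  congr 1
  exact Subtype.ext hy.symm

/-- The quadratic form of `(P - b A x)² + W`, given `ψ` and `g = (P - b A x) ψ`. -/
lemma HasLandau.inner_self_eq {b : ℝ} {W : Plane → ℝ} (hW : IsBddMeas W) {ψ f : L2} {g : L2Vec}
    (h : HasLandau b ψ f) (hg : HasMagGrad b ψ g) :
    inner ℂ ψ (f + rmul W hW ψ) = ((‖g‖ ^ 2 + ∫ x, W x * ‖ψ x‖ ^ 2 : ℝ) : ℂ) := by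
  rw [inner_add_right, ← h.inner_eq hg hg, inner_rmul_self, inner_self_eq_norm_sq_to_K]
  push_cast
  rfl

/-! ### Smooth cutoffs and the localization formula -/

/-- The `j`-th partial derivative of a real function on the plane. -/
def partialDeriv (j : Fin 2) (χ : Plane → ℝ) (x : Plane) : ℝ :=
  fderiv ℝ χ x (EuclideanSpace.single j 1)

/-- A smooth bounded real function with bounded first derivatives. -/
structure IsCutoff (χ : Plane → ℝ) : Prop where
  smooth : ContDiff ℝ ∞ χ
  bdd : IsBddMeas χ
  bdd_partialDeriv : ∀ j, IsBddMeas (partialDeriv j χ)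

/-- `(P - b A x) (χ ψ)`, in terms of `g = (P - b A x) ψ`. -/
def mulGrad (χ : Plane → ℝ) (h : IsCutoff χ) (ψ : L2) (g : L2Vec) : L2Vec :=
  WithLp.toLp 2 fun j =>
    rmul χ h.bdd (g j) + (-Complex.I) • rmul (partialDeriv j χ) (h.bdd_partialDeriv j) ψ

lemma coeFn_mulGrad {χ : Plane → ℝ} (h : IsCutoff χ) (ψ : L2) (g : L2Vec) (j : Fin 2) :
    (mulGrad χ h ψ g j : Plane → ℂ) =ᵐ[volume]
      fun x => (χ x : ℂ) * g j x - Complex.I * (partialDeriv j χ x * ψ x) := by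
  change ((rmul χ h.bdd (g j) + (-Complex.I) • rmul (partialDeriv j χ) (h.bdd_partialDeriv j) ψ :
    L2) : Plane → ℂ) =ᵐ[volume] _
  filter_upwards [coeFn_rmul h.bdd (g j), coeFn_rmul (h.bdd_partialDeriv j) ψ,
    Lp.coeFn_add (rmul χ h.bdd (g j))
      ((-Complex.I) • rmul (partialDeriv j χ) (h.bdd_partialDeriv j) ψ),
    Lp.coeFn_smul (-Complex.I) (rmul (partialDeriv j χ) (h.bdd_partialDeriv j) ψ)]
    with x h1 h2 h3 h4
  rw [h3, Pi.add_apply, h4, Pi.smul_apply, h1, h2, smul_eq_mul]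
  ring

lemma magMomentum_mul {b : ℝ} {j : Fin 2} {χ : Plane → ℝ} {η : Plane → ℂ} {x : Plane}
    (hχ : DifferentiableAt ℝ χ x) (hη : DifferentiableAt ℝ η x) :
    magMomentum b j (fun y => (χ y : ℂ) * η y) x
      = χ x * magMomentum b j η x - Complex.I * (partialDeriv j χ x * η x) := by
  have h1 : HasFDerivAt (fun y => (χ y : ℂ)) (Complex.ofRealCLM.comp (fderiv ℝ χ x)) x :=
    Complex.ofRealCLM.hasFDerivAt.comp x hχ.hasFDerivAt
  have h2 := (h1.mul hη.hasFDerivAt).fderiv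
  have h3 := congrArg (fun L : Plane →L[ℝ] ℂ => L (EuclideanSpace.single j 1)) h2
  simp only [magMomentum, partialDeriv]
  rw [show (fun y => (χ y : ℂ) * η y) = (fun y => (χ y : ℂ)) * η from rfl, h3]
  simp
  ring

/-- A real `χ` can be moved onto the test function; the Leibniz rule for `χ η` then produces the
commutator term `-i ∂χ ψ`. -/
lemma HasMagGrad.mul {b : ℝ} {ψ : L2} {g : L2Vec} (hg : HasMagGrad b ψ g) {χ : Plane → ℝ}
    (h : IsCutoff χ) : HasMagGrad b (rmul χ h.bdd ψ) (mulGrad χ h ψ g) := by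
  intro j η hη hc
  have hχη : ContDiff ℝ ∞ fun y => (χ y : ℂ) * η y :=
    (Complex.ofRealCLM.contDiff.comp h.smooth).mul hη
  have hcχη : HasCompactSupport fun y => (χ y : ℂ) * η y := hc.mul_left
  have key := hg j _ hχη hcχη
  have hp : Continuous fun x => (partialDeriv j χ x : ℂ) * η x := by
    have : Continuous fun x => partialDeriv j χ x :=
      (h.smooth.continuous_fderiv (by simp)).clm_apply continuous_const
    have := hη.continuous
    fun_prop
  have hcp : HasCompactSupport fun x => (partialDeriv j χ x : ℂ) * η x := hc.mul_left
  have i1 := integrable_conj_mul (continuous_magMomentum b j hχη)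
    (hasCompactSupport_magMomentum b j hcχη) ψ
  have i2 := integrable_conj_mul hp hcp ψ
  have i3 := integrable_conj_mul hχη.continuous hcχη (g j)
  have e1 : ∫ x, conj (magMomentum b j η x) * (rmul χ h.bdd ψ : L2) x
      = (∫ x, conj (magMomentum b j (fun y => (χ y : ℂ) * η y) x) * ψ x)
        - Complex.I * ∫ x, conj ((partialDeriv j χ x : ℂ) * η x) * ψ x := by
    rw [← integral_const_mul, ← integral_sub i1 (i2.const_mul _)]
    refine integral_congr_ae ?_
    filter_upwards [coeFn_rmul h.bdd ψ] with x hx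
    rw [hx, magMomentum_mul (h.smooth.differentiable (by simp) x) (hη.differentiable (by simp) x)]
    simp only [map_sub, map_mul, Complex.conj_ofReal, Complex.conj_I]
    ring
  have e2 : ∫ x, conj (η x) * (mulGrad χ h ψ g j : L2) x
      = (∫ x, conj ((χ x : ℂ) * η x) * g j x)
        - Complex.I * ∫ x, conj ((partialDeriv j χ x : ℂ) * η x) * ψ x := by
    rw [← integral_const_mul, ← integral_sub i3 (i2.const_mul _)]
    refine integral_congr_ae ?_
    filter_upwards [coeFn_mulGrad h ψ g j] with x hx
    rw [hx]
    simp only [map_mul, Complex.conj_ofReal]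
    ring
  rw [e1, e2, key]

/-- The localization error of the pair `χ, χ'`. -/
def gradSq (χ χ' : Plane → ℝ) (x : Plane) : ℝ :=
  ∑ j, (partialDeriv j χ x ^ 2 + partialDeriv j χ' x ^ 2)

lemma IsBddMeas.sq {w : Plane → ℝ} (h : IsBddMeas w) : IsBddMeas fun x => w x ^ 2 := by
  obtain ⟨C, hC⟩ := h.bounded
  refine ⟨h.measurable.pow_const 2, C ^ 2, fun x => ?_⟩
  rw [norm_pow]
  exact pow_le_pow_left₀ (norm_nonneg _) (hC x) 2

lemma IsBddMeas.add {w w' : Plane → ℝ} (h : IsBddMeas w) (h' : IsBddMeas w') :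
    IsBddMeas fun x => w x + w' x := by
  obtain ⟨C, hC⟩ := h.bounded
  obtain ⟨C', hC'⟩ := h'.bounded
  exact ⟨h.measurable.add h'.measurable, C + C', fun x =>
    (norm_add_le _ _).trans (add_le_add (hC x) (hC' x))⟩

lemma IsBddMeas.const_mul {w : Plane → ℝ} (h : IsBddMeas w) (c : ℝ) :
    IsBddMeas fun x => c * w x := by
  obtain ⟨C, hC⟩ := h.bounded
  refine ⟨h.measurable.const_mul c, |c| * C, fun x => ?_⟩
  rw [norm_mul, Real.norm_eq_abs c]
  exact mul_le_mul_of_nonneg_left (hC x) (abs_nonneg _)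

lemma IsBddMeas.mul {w w' : Plane → ℝ} (h : IsBddMeas w) (h' : IsBddMeas w') :
    IsBddMeas fun x => w x * w' x := by
  obtain ⟨C, hC⟩ := h.bounded
  obtain ⟨C', hC'⟩ := h'.bounded
  refine ⟨h.measurable.mul h'.measurable, C * C', fun x => ?_⟩
  rw [norm_mul]
  exact mul_le_mul (hC x) (hC' x) (norm_nonneg _) ((norm_nonneg _).trans (hC x))

lemma isBddMeas_const (c : ℝ) : IsBddMeas fun _ : Plane => c :=
  ⟨measurable_const, ‖c‖, fun _ => le_rfl⟩

lemma isBddMeas_gradSq {χ χ' : Plane → ℝ} (h : IsCutoff χ) (h' : IsCutoff χ') :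
    IsBddMeas (gradSq χ χ') := by
  have := (((h.bdd_partialDeriv 0).sq.add (h'.bdd_partialDeriv 0).sq).add
    ((h.bdd_partialDeriv 1).sq.add (h'.bdd_partialDeriv 1).sq))
  have e : gradSq χ χ' = fun x => (partialDeriv 0 χ x ^ 2 + partialDeriv 0 χ' x ^ 2)
      + (partialDeriv 1 χ x ^ 2 + partialDeriv 1 χ' x ^ 2) := by
    funext x
    simp [gradSq, Fin.sum_univ_two]
  rw [e]
  exact this

/-- Obtained by differentiating `χ² + χ'² = 1`. It removes the cross terms in the localization
formula. -/
lemma mul_partialDeriv_add_eq_zero {χ χ' : Plane → ℝ} (h : IsCutoff χ) (h' : IsCutoff χ')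
    (h1 : ∀ x, χ x ^ 2 + χ' x ^ 2 = 1) (j : Fin 2) (x : Plane) :
    χ x * partialDeriv j χ x + χ' x * partialDeriv j χ' x = 0 := by
  have d := ((h.smooth.differentiable (by simp) x).hasFDerivAt.pow 2).add
    ((h'.smooth.differentiable (by simp) x).hasFDerivAt.pow 2)
  have d0 : HasFDerivAt (fun y => χ y ^ 2 + χ' y ^ 2) (0 : Plane →L[ℝ] ℝ) x := by
    simp only [h1]
    exact hasFDerivAt_const _ _
  have e := congrArg (fun L : Plane →L[ℝ] ℝ => L (EuclideanSpace.single j 1)) (d.unique d0)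
  simp at e
  simp only [partialDeriv]
  linarith

lemma norm_sq_l2Vec (g : L2Vec) : ‖g‖ ^ 2 = ∑ j, ‖g j‖ ^ 2 := PiLp.norm_sq_eq_of_L2 _ _

/-- The IMS localization formula. -/
lemma norm_sq_eq_localization {χ χ' : Plane → ℝ} (h : IsCutoff χ) (h' : IsCutoff χ')
    (h1 : ∀ x, χ x ^ 2 + χ' x ^ 2 = 1) (ψ : L2) (g : L2Vec) :
    ‖g‖ ^ 2 = ‖mulGrad χ h ψ g‖ ^ 2 + ‖mulGrad χ' h' ψ g‖ ^ 2
      - ∫ x, gradSq χ χ' x * ‖ψ x‖ ^ 2 := by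
  have hj : ∀ j, ‖g j‖ ^ 2 = ‖mulGrad χ h ψ g j‖ ^ 2 + ‖mulGrad χ' h' ψ g j‖ ^ 2
      - ∫ x, (partialDeriv j χ x ^ 2 + partialDeriv j χ' x ^ 2) * ‖ψ x‖ ^ 2 := by
    intro j
    have i := ((h.bdd_partialDeriv j).sq.add (h'.bdd_partialDeriv j).sq).integrable_mul_norm_sq ψ
    have i' : Integrable fun x => ‖(mulGrad χ h ψ g j : L2) x‖ ^ 2
        + ‖(mulGrad χ' h' ψ g j : L2) x‖ ^ 2 :=
      (integrable_norm_sq _).add (integrable_norm_sq _)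
    rw [norm_sq_eq_integral, norm_sq_eq_integral, norm_sq_eq_integral,
      ← integral_add (integrable_norm_sq _) (integrable_norm_sq _), ← integral_sub i' i]
    refine integral_congr_ae ?_
    filter_upwards [coeFn_mulGrad h ψ g j, coeFn_mulGrad h' ψ g j] with x e e'
    have h0 := mul_partialDeriv_add_eq_zero h h' h1 j x
    have h2 := h1 x
    rw [e, e']
    simp only [← Complex.normSq_eq_norm_sq, Complex.normSq_apply, Complex.sub_re, Complex.sub_im,
      Complex.mul_re, Complex.mul_im, Complex.ofReal_re, Complex.ofReal_im, Complex.I_re,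
      Complex.I_im]
    -- Expanding `|χ g - i ∂χ ψ|²` gives the cross term `2 χ ∂χ (Re g Im ψ - Im g Re ψ)`; summed
    -- over the pair it is a multiple of `h0`.
    linear_combination (-((g j x).re ^ 2 + (g j x).im ^ 2)) * h2
      - 2 * ((g j x).re * (ψ x).im - (g j x).im * (ψ x).re) * h0
  have e : ∫ x, gradSq χ χ' x * ‖ψ x‖ ^ 2
      = ∑ j, ∫ x, (partialDeriv j χ x ^ 2 + partialDeriv j χ' x ^ 2) * ‖ψ x‖ ^ 2 := by
    rw [← integral_finsetSum _ fun j _ =>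
      ((h.bdd_partialDeriv j).sq.add (h'.bdd_partialDeriv j).sq).integrable_mul_norm_sq ψ]
    refine integral_congr_ae (Eventually.of_forall fun x => ?_)
    simp only [gradSq]
    rw [Finset.sum_mul]
  rw [norm_sq_l2Vec, norm_sq_l2Vec, norm_sq_l2Vec, e, ← Finset.sum_add_distrib,
    ← Finset.sum_sub_distrib]
  exact Finset.sum_congr rfl fun j _ => hj j

/-! ### Magnetic translations -/

/-- The magnetic translation of a function. -/
def translateFun (b : ℝ) (z : Plane) (η : Plane → ℂ) (x : Plane) : ℂ :=
  Complex.exp (Complex.I * (b * inner ℝ x (vecPot z) : ℝ)) * η (x - z)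

lemma coeFn_magTranslate (b : ℝ) (z : Plane) (φ : L2) :
    (magTranslate b z φ : Plane → ℂ) =ᵐ[volume] translateFun b z φ :=
  (memLp_magTranslate b z φ).coeFn_toLp

lemma norm_translateFun (b : ℝ) (z : Plane) (η : Plane → ℂ) (x : Plane) :
    ‖translateFun b z η x‖ = ‖η (x - z)‖ := by
  rw [translateFun, norm_mul, mul_comm Complex.I, Complex.norm_exp_ofReal_mul_I, one_mul]

lemma comp_sub_ae {E : Type*} {f g : Plane → E} (h : f =ᵐ[volume] g) (z : Plane) :
    (fun x => f (x - z)) =ᵐ[volume] fun x => g (x - z) :=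
  (measurePreserving_sub_right volume z).quasiMeasurePreserving.ae_eq_comp h

lemma translateFun_congr_ae {b : ℝ} {z : Plane} {η θ : Plane → ℂ} (h : η =ᵐ[volume] θ) :
    translateFun b z η =ᵐ[volume] translateFun b z θ := by
  filter_upwards [comp_sub_ae h z] with x hx
  rw [translateFun, translateFun, hx]

lemma inner_plane (x y : Plane) : inner ℝ x y = x 0 * y 0 + x 1 * y 1 := by
  simp [PiLp.inner_apply, Fin.sum_univ_two]
  ring

lemma inner_vecPot_self (z : Plane) : inner ℝ z (vecPot z) = 0 := by
  rw [inner_plane]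
  simp [vecPot]
  ring

lemma vecPot_neg (z : Plane) : vecPot (-z) = -vecPot z := by
  ext j
  fin_cases j <;> simp [vecPot] <;> ring

lemma vecPot_sub_apply (x z : Plane) (j : Fin 2) :
    vecPot (x - z) j = vecPot x j - vecPot z j := by
  fin_cases j <;> simp [vecPot] <;> ring

lemma magTranslate_add (b : ℝ) (z : Plane) (φ ψ : L2) :
    magTranslate b z (φ + ψ) = magTranslate b z φ + magTranslate b z ψ := by
  ext1
  filter_upwards [coeFn_magTranslate b z (φ + ψ), coeFn_magTranslate b z φ,
    coeFn_magTranslate b z ψ, Lp.coeFn_add (magTranslate b z φ) (magTranslate b z ψ),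
    comp_sub_ae (Lp.coeFn_add φ ψ) z] with x h1 h2 h3 h4 h5
  rw [h1, h4, Pi.add_apply, h2, h3, translateFun, h5, Pi.add_apply, mul_add]
  rfl

lemma magTranslate_smul (b : ℝ) (z : Plane) (c : ℂ) (φ : L2) :
    magTranslate b z (c • φ) = c • magTranslate b z φ := by
  ext1
  filter_upwards [coeFn_magTranslate b z (c • φ), coeFn_magTranslate b z φ,
    Lp.coeFn_smul c (magTranslate b z φ), comp_sub_ae (Lp.coeFn_smul c φ) z] with x h1 h2 h4 h5
  rw [h1, h4, Pi.smul_apply, h2, translateFun, h5, Pi.smul_apply, translateFun, smul_eq_mul,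
    smul_eq_mul, mul_left_comm]

lemma integral_weight_magTranslate (b : ℝ) (z : Plane) (w : Plane → ℝ) (φ : L2) :
    ∫ x, w x * ‖magTranslate b z φ x‖ ^ 2 = ∫ x, w (x + z) * ‖φ x‖ ^ 2 := by
  rw [← integral_sub_right_eq_self (fun x => w (x + z) * ‖φ x‖ ^ 2) z]
  refine integral_congr_ae ?_
  filter_upwards [coeFn_magTranslate b z φ] with x hx
  rw [hx, norm_translateFun, sub_add_cancel]

lemma norm_magTranslate (b : ℝ) (z : Plane) (φ : L2) : ‖magTranslate b z φ‖ = ‖φ‖ := by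
  have h := integral_weight_magTranslate b z (fun _ => 1) φ
  simp only [one_mul] at h
  rw [← norm_sq_eq_integral, ← norm_sq_eq_integral] at h
  exact (pow_left_inj₀ (norm_nonneg _) (norm_nonneg _) two_ne_zero).1 h

/-- The magnetic translation as a linear isometry. -/
def magTranslateLI (b : ℝ) (z : Plane) : L2 →ₗᵢ[ℂ] L2 where
  toFun := magTranslate b z
  map_add' := magTranslate_add b z
  map_smul' := magTranslate_smul b z
  norm_map' := norm_magTranslate b z

/-- The two phases cancel exactly because `A z` is orthogonal to `z`; for general pairs of shifts a
phase would remain. -/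
lemma translateFun_neg_translateFun (b : ℝ) (z : Plane) (η : Plane → ℂ) :
    translateFun b (-z) (translateFun b z η) = η := by
  funext x
  rw [translateFun, translateFun, ← mul_assoc, ← Complex.exp_add, sub_neg_eq_add,
    add_sub_cancel_right, vecPot_neg, inner_neg_right, inner_add_left, inner_vecPot_self, add_zero, ← mul_add,
    ← Complex.ofReal_add, mul_neg, neg_add_cancel]
  simp

lemma magTranslate_neg_magTranslate (b : ℝ) (z : Plane) (φ : L2) :
    magTranslate b (-z) (magTranslate b z φ) = φ := by
  ext1
  filter_upwards [coeFn_magTranslate b (-z) (magTranslate b z φ),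
    translateFun_congr_ae (b := b) (z := -z) (coeFn_magTranslate b z φ)] with x h1 h2
  rw [h1, h2, translateFun_neg_translateFun]

lemma inner_magTranslate_right (b : ℝ) (z : Plane) (f g : L2) :
    inner ℂ f (magTranslate b z g) = inner ℂ (magTranslate b (-z) f) g := by
  have h := (magTranslateLI b (-z)).inner_map_map f (magTranslate b z g)
  rw [← h]
  change inner ℂ (magTranslate b (-z) f) (magTranslate b (-z) (magTranslate b z g)) = _
  rw [magTranslate_neg_magTranslate]

lemma integral_conj_mul_magTranslate (b : ℝ) (z : Plane) (u : Plane → ℂ) (ψ : L2) :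
    ∫ x, conj (u x) * magTranslate b z ψ x = ∫ x, conj (translateFun b (-z) u x) * ψ x := by
  rw [← integral_sub_right_eq_self (fun x => conj (translateFun b (-z) u x) * ψ x) z]
  refine integral_congr_ae ?_
  filter_upwards [coeFn_magTranslate b z ψ] with x hx
  rw [hx, translateFun, translateFun, map_mul, ← Complex.exp_conj, map_mul, Complex.conj_I,
    Complex.conj_ofReal, vecPot_neg, inner_neg_right, inner_sub_left, inner_vecPot_self, sub_zero,
    sub_neg_eq_add, sub_add_cancel]
  push_cast
  ring_nf

lemma contDiff_translateFun (b : ℝ) (z : Plane) {η : Plane → ℂ} (hη : ContDiff ℝ ∞ η) :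
    ContDiff ℝ ∞ (translateFun b z η) := by
  unfold translateFun
  refine ContDiff.mul (ContDiff.cexp (contDiff_const.mul ?_))
    (hη.comp (contDiff_id.sub contDiff_const))
  exact Complex.ofRealCLM.contDiff.comp (contDiff_const.mul (contDiff_id.inner ℝ contDiff_const))

lemma hasCompactSupport_translateFun (b : ℝ) (z : Plane) {η : Plane → ℂ}
    (hη : HasCompactSupport η) : HasCompactSupport (translateFun b z η) := by
  have h : HasCompactSupport fun x => η (x - z) := by
    have := hη.comp_homeomorph (Homeomorph.subRight z)
    exact this
  exact h.mul_left

/-- Differentiating the phase adds `b A z` to the momentum, and `A x - A z = A (x - z)` by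
linearity. This is why magnetic translations, rather than ordinary ones, commute with `P - b A x`.
-/
lemma magMomentum_translateFun (b : ℝ) (z : Plane) (j : Fin 2) {η : Plane → ℂ}
    (hη : Differentiable ℝ η) (x : Plane) :
    magMomentum b j (translateFun b z η) x = translateFun b z (magMomentum b j η) x := by
  have h1 : HasFDerivAt (fun y : Plane => Complex.I * (b * inner ℝ y (vecPot z) : ℝ))
      (Complex.I • Complex.ofRealCLM.comp (b • innerSL ℝ (vecPot z))) x := by
    have : HasFDerivAt (fun y : Plane => b * inner ℝ y (vecPot z)) (b • innerSL ℝ (vecPot z)) x := by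
      have := ((innerSL ℝ (vecPot z)).hasFDerivAt (x := x)).const_mul b
      simpa [real_inner_comm] using this
    exact (Complex.ofRealCLM.hasFDerivAt.comp x this).const_mul Complex.I
  have h2 : HasFDerivAt (fun y => η (y - z)) (fderiv ℝ η (x - z)) x := by
    have := (hη (x - z)).hasFDerivAt.comp x ((hasFDerivAt_id x).sub_const z)
    rw [ContinuousLinearMap.comp_id] at this
    exact this
  have h3 := (h1.cexp.mul h2).fderiv
  have h4 := congrArg (fun L : Plane →L[ℝ] ℂ => L (EuclideanSpace.single j 1)) h3
  have h5 : inner ℝ (vecPot z) (EuclideanSpace.single j (1 : ℝ)) = vecPot z j := by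
    rw [inner_plane]
    fin_cases j <;> simp
  have h6 : magMomentum b j (translateFun b z η) x = -Complex.I * fderiv ℝ (translateFun b z η) x
      (EuclideanSpace.single j 1) - (b * vecPot x j : ℝ) * translateFun b z η x := rfl
  rw [h6, show translateFun b z η = (fun y : Plane => Complex.exp (Complex.I *
    (b * inner ℝ y (vecPot z) : ℝ))) * fun y => η (y - z) from rfl, h4]
  simp only [translateFun, magMomentum, vecPot_sub_apply, add_apply,
    smul_apply, ContinuousLinearMap.comp_apply, innerSL_apply_apply, h5,
    Complex.ofRealCLM_apply, smul_eq_mul, Pi.mul_apply]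
  generalize Complex.exp (Complex.I * (b * inner ℝ x (vecPot z) : ℝ)) = E
  push_cast
  linear_combination (-E * η (x - z) * b * vecPot z j) * Complex.I_sq

/-- The componentwise magnetic translation of a vector field. -/
def magTranslateVec (b : ℝ) (z : Plane) (g : L2Vec) : L2Vec :=
  WithLp.toLp 2 fun j => magTranslate b z (g j)

lemma norm_magTranslateVec (b : ℝ) (z : Plane) (g : L2Vec) : ‖magTranslateVec b z g‖ = ‖g‖ := by
  refine (pow_left_inj₀ (norm_nonneg _) (norm_nonneg _) two_ne_zero).1 ?_
  rw [norm_sq_l2Vec, norm_sq_l2Vec]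
  exact Finset.sum_congr rfl fun j _ => by
    rw [← norm_magTranslate b z (g j)]; rfl

lemma inner_magTranslateVec_right (b : ℝ) (z : Plane) (f g : L2Vec) :
    inner ℂ f (magTranslateVec b z g) = inner ℂ (magTranslateVec b (-z) f) g := by
  rw [PiLp.inner_apply, PiLp.inner_apply]
  exact Finset.sum_congr rfl fun j _ => inner_magTranslate_right b z _ _

lemma HasMagGrad.magTranslate {b : ℝ} {ψ : L2} {g : L2Vec} (h : HasMagGrad b ψ g) (z : Plane) :
    HasMagGrad b (magTranslate b z ψ) (magTranslateVec b z g) := by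
  intro j η hη hc
  change _ = ∫ x, conj (η x) * MagneticDoubleWell.magTranslate b z (g j) x
  rw [integral_conj_mul_magTranslate, integral_conj_mul_magTranslate,
    ← h j _ (contDiff_translateFun b (-z) hη) (hasCompactSupport_translateFun b (-z) hc)]
  simp only [magMomentum_translateFun b (-z) j (hη.differentiable (by simp))]

lemma HasLandau.magTranslate {b : ℝ} {ψ f : L2} (h : HasLandau b ψ f) (z : Plane) :
    HasLandau b (magTranslate b z ψ) (magTranslate b z f) := by
  obtain ⟨g, hg, h'⟩ := h
  refine ⟨_, hg.magTranslate z, fun u gu hu => ?_⟩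
  rw [inner_magTranslateVec_right, inner_magTranslate_right]
  exact h' _ _ (hu.magTranslate (-z))

/-! ### Two facts about Hilbert spaces -/

/-- The Lax-Milgram theorem on a closed subspace. -/
lemma exists_forall_inner_eq_of_coercive {H : Type*} [NormedAddCommGroup H] [InnerProductSpace ℂ H]
    [CompleteSpace H] {S : Submodule ℂ H} (hS : IsClosed (S : Set H)) (T : H →L[ℂ] H) {C : ℝ}
    (hC : 0 < C) (h : ∀ p ∈ S, C * ‖p‖ ^ 2 ≤ (inner ℂ p (T p)).re) (f : H) :
    ∃ q ∈ S, ∀ p ∈ S, inner ℂ p (T q) = inner ℂ p f := by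
  have : CompleteSpace S := hS.completeSpace_coe
  let ι := S.subtypeL
  let R := ContinuousLinearMap.adjoint ι ∘L T ∘L ι
  have hR : ∀ p q : S, inner ℂ p (R q) = inner ℂ (p : H) (T q) := by
    intro p q
    change inner ℂ p (ContinuousLinearMap.adjoint ι (T q)) = _
    rw [ContinuousLinearMap.adjoint_inner_right]
    rfl
  -- Coercivity keeps the quadratic form of the compression of `T` to `S` away from zero, which
  -- makes that compression invertible.
  have hunit : IsUnit R := by
    refine ContinuousLinearMap.isUnit_of_forall_le_norm_inner_map R (c := ⟨C, hC.le⟩) hC fun p => ?_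
    rw [norm_inner_symm, hR, mul_comm]
    exact (h p p.2).trans ((le_abs_self _).trans (Complex.abs_re_le_norm _))
  obtain ⟨V, hV⟩ := hunit.exists_right_inv
  let F : S := ContinuousLinearMap.adjoint ι f
  have hq : R (V F) = F := by
    change (R * V) F = F
    rw [hV]; rfl
  refine ⟨V F, (V F).2, fun p hp => ?_⟩
  have h1 := hR ⟨p, hp⟩ (V F)
  rw [hq] at h1
  rw [← show _ = inner ℂ p (T (V F)) from h1]
  change inner ℂ _ (ContinuousLinearMap.adjoint ι f) = _
  rw [ContinuousLinearMap.adjoint_inner_right]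
  rfl

/-- The component of `p` orthogonal to the closure of `D` still lies in `S`, so the hypothesis
annihilates it. It is applied with `S` the form domain and `D` the operator domain. -/
lemma mem_closure_of_forall_inner_eq_zero {H : Type*} [NormedAddCommGroup H]
    [InnerProductSpace ℂ H] [CompleteSpace H] {S D : Submodule ℂ H} (hS : IsClosed (S : Set H))
    (hD : ∀ p ∈ S, (∀ q ∈ D, inner ℂ p q = 0) → p = 0) (hDS : D ≤ S) {p : H} (hp : p ∈ S) :
    p ∈ closure (D : Set H) := by
  have hc : CompleteSpace D.topologicalClosure := D.isClosed_topologicalClosure.completeSpace_coe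
  have hle : D.topologicalClosure ≤ S := D.topologicalClosure_minimal hDS hS
  obtain ⟨y, hy, z, hz, rfl⟩ := D.topologicalClosure.exists_add_mem_mem_orthogonal p
  have hzS : z ∈ S := by simpa using S.sub_mem hp (hle hy)
  have hz0 : z = 0 := hD z hzS fun q hq =>
    (Submodule.mem_orthogonal' _ _).1 hz q (D.le_topologicalClosure hq)
  rw [hz0, add_zero]
  exact hy

/-! ### The form domain as a Hilbert space -/

lemma exists_inner_eq_integral {u : Plane → ℂ} (hu : Continuous u) (hc : HasCompactSupport u) :
    ∃ U : L2, ∀ ψ : L2, ∫ x, conj (u x) * ψ x = inner ℂ U ψ := by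
  have hM := hu.memLp_of_hasCompactSupport (μ := volume) (p := 2) hc
  refine ⟨hM.toLp u, fun ψ => ?_⟩
  rw [L2.inner_def]
  refine integral_congr_ae ?_
  filter_upwards [hM.coeFn_toLp] with x hx
  rw [hx, RCLike.inner_apply, mul_comm]

/-- The Hilbert space `L²(ℝ²; ℂ) ⊕ L²(ℝ²; ℂ²)`. -/
def GraphSpace : Type := WithLp 2 (L2 × L2Vec)

namespace GraphSpace

instance : NormedAddCommGroup GraphSpace :=
  inferInstanceAs (NormedAddCommGroup (WithLp 2 (L2 × L2Vec)))

instance : InnerProductSpace ℂ GraphSpace :=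
  inferInstanceAs (InnerProductSpace ℂ (WithLp 2 (L2 × L2Vec)))

instance : CompleteSpace GraphSpace :=
  inferInstanceAs (CompleteSpace (WithLp 2 (L2 × L2Vec)))

/-- The first component. -/
def fst : GraphSpace →L[ℂ] L2 := WithLp.fstL 2 ℂ L2 L2Vec

/-- The second component. -/
def snd : GraphSpace →L[ℂ] L2Vec := WithLp.sndL 2 ℂ L2 L2Vec

/-- The pair with given components. -/
def mk : L2 × L2Vec →L[ℂ] GraphSpace :=
  ((WithLp.prodContinuousLinearEquiv 2 ℂ L2 L2Vec).symm : L2 × L2Vec →L[ℂ] WithLp 2 (L2 × L2Vec))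

lemma fst_mk (p : L2 × L2Vec) : fst (mk p) = p.1 := rfl

lemma snd_mk (p : L2 × L2Vec) : snd (mk p) = p.2 := rfl

lemma eq_zero {p : GraphSpace} (h1 : fst p = 0) (h2 : snd p = 0) : p = 0 :=
  WithLp.ofLp_injective 2 (Prod.ext h1 h2)

lemma inner_eq (p q : GraphSpace) :
    inner ℂ p q = inner ℂ (fst p) (fst q) + inner ℂ (snd p) (snd q) := rfl

lemma norm_sq_eq (p : GraphSpace) : ‖p‖ ^ 2 = ‖fst p‖ ^ 2 + ‖snd p‖ ^ 2 :=
  WithLp.prod_norm_sq_eq_of_L2 _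

end GraphSpace

open GraphSpace in
/-- The elements of a subspace `K` in the form domain, with the graph inner product. -/
def formSpace (b : ℝ) (K : Submodule ℂ L2) : Submodule ℂ GraphSpace :=
  (K.prod ⊤ ⊓ magGradGraph b).comap (fst.prod snd : GraphSpace →ₗ[ℂ] L2 × L2Vec)

open GraphSpace in
lemma mem_formSpace {b : ℝ} {K : Submodule ℂ L2} {p : GraphSpace} :
    p ∈ formSpace b K ↔ fst p ∈ K ∧ HasMagGrad b (fst p) (snd p) := by
  change ((fst p ∈ K ∧ snd p ∈ (⊤ : Submodule ℂ L2Vec)) ∧ HasMagGrad b (fst p) (snd p)) ↔ _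
  simp

-- Each test function imposes the equality of two continuous functionals of the pair, so the weak
-- gradient is a closed operator.
open GraphSpace in
lemma isClosed_formSpace (b : ℝ) {K : Submodule ℂ L2} (hK : IsClosed (K : Set L2)) :
    IsClosed (formSpace b K : Set GraphSpace) := by
  have e : (formSpace b K : Set GraphSpace) =
      {p | fst p ∈ K} ∩ {p | HasMagGrad b (fst p) (snd p)} := by
    ext p
    exact mem_formSpace
  rw [e]
  refine (hK.preimage fst.continuous).inter ?_
  simp only [HasMagGrad, IsWeakMagMomentum, Set.ofPred_forall]
  refine isClosed_iInter fun j => isClosed_iInter fun η => isClosed_iInter fun hη =>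
    isClosed_iInter fun hc => ?_
  obtain ⟨U, hU⟩ := exists_inner_eq_integral (continuous_magMomentum b j hη)
    (hasCompactSupport_magMomentum b j hc)
  obtain ⟨U', hU'⟩ := exists_inner_eq_integral hη.continuous hc
  simp only [hU, hU']
  have hs : Continuous fun p : GraphSpace => snd p j :=
    (PiLp.continuous_apply 2 _ j).comp snd.continuous
  exact isClosed_eq (continuous_const.inner fst.continuous) (continuous_const.inner hs)

open GraphSpace in
/-- Weak solutions of `((P - b A x)² + B) ψ = f` in a closed subspace, for a coercive form. -/
lemma exists_weak_solution {b : ℝ} {K : Submodule ℂ L2} (hK : IsClosed (K : Set L2))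
    (B : L2 →L[ℂ] L2) {C : ℝ} (hC : 0 < C)
    (h : ∀ u g, u ∈ K → HasMagGrad b u g →
      C * (‖u‖ ^ 2 + ‖g‖ ^ 2) ≤ ‖g‖ ^ 2 + (inner ℂ u (B u)).re) (f : L2) :
    ∃ ψ ∈ K, ∃ g, HasMagGrad b ψ g ∧
      ∀ u ∈ K, ∀ gu, HasMagGrad b u gu → inner ℂ gu g + inner ℂ u (B ψ) = inner ℂ u f := by
  -- `T` is `B` on the function and the identity on its gradient, so its form is the energy form
  -- with potential term `B`.
  let T : GraphSpace →L[ℂ] GraphSpace := mk ∘L ((B ∘L fst).prod snd)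
  have hT : ∀ p q, inner ℂ p (T q) = inner ℂ (snd p) (snd q) + inner ℂ (fst p) (B (fst q)) := by
    intro p q
    rw [inner_eq, add_comm]
    rfl
  obtain ⟨q, hq, hq'⟩ := exists_forall_inner_eq_of_coercive (isClosed_formSpace b hK) T hC
    (fun p hp => by
      rw [hT, norm_sq_eq, Complex.add_re, inner_self_eq_norm_sq_to_K]
      have h3 : ∀ r : ℝ, (((r : ℂ)) ^ 2).re = r ^ 2 := fun r => by norm_cast
      change _ ≤ (((‖snd p‖ : ℝ) : ℂ) ^ 2).re + _
      rw [h3]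
      exact h _ _ (mem_formSpace.1 hp).1 (mem_formSpace.1 hp).2) (mk (f, 0))
  refine ⟨_, (mem_formSpace.1 hq).1, _, (mem_formSpace.1 hq).2, fun u hu gu hgu => ?_⟩
  have h1 := hq' (mk (u, gu)) (mem_formSpace.2 ⟨hu, hgu⟩)
  rw [hT, inner_eq] at h1
  simp only [fst_mk, snd_mk, inner_zero_right, add_zero] at h1
  exact h1

/-! ### The operator domain is a form core -/

/-- The form of `(P - b A x)² + 1` is the squared graph norm itself, hence coercive with constant
one. -/
lemma exists_landau_add_self_eq (b : ℝ) (f : L2) : ∃ ψ k, HasLandau b ψ k ∧ k + ψ = f := by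
  obtain ⟨ψ, -, g, hg, h⟩ := exists_weak_solution (b := b) (K := ⊤) isClosed_univ
    (ContinuousLinearMap.id ℂ L2) one_pos (fun u g _ _ => by
      have : (inner ℂ u (ContinuousLinearMap.id ℂ L2 u)).re = ‖u‖ ^ 2 := by
        rw [ContinuousLinearMap.id_apply, inner_self_eq_norm_sq_to_K]
        norm_cast
      rw [this, one_mul, add_comm]) f
  refine ⟨ψ, f - ψ, ⟨g, hg, fun u gu hu => ?_⟩, sub_add_cancel _ _⟩
  have := h u trivial gu hu
  rw [inner_sub_right, ← this]
  simp

open GraphSpace in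
/-- The domain of `(P - b A x)²`, as a subspace of the form domain. -/
def landauFormSpace (b : ℝ) : Submodule ℂ GraphSpace where
  carrier := {p | (∃ f, HasLandau b (fst p) f) ∧ HasMagGrad b (fst p) (snd p)}
  zero_mem' := by
    refine ⟨⟨0, ?_⟩, ?_⟩
    · rw [map_zero]
      exact hasLandau_iff.2 (Submodule.zero_mem _)
    · rw [map_zero, map_zero]
      exact (magGradGraph b).zero_mem
  add_mem' := by
    rintro p q ⟨⟨f, hf⟩, hp⟩ ⟨⟨f', hf'⟩, hq⟩
    refine ⟨⟨f + f', ?_⟩, ?_⟩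
    · rw [map_add]
      exact hf.add hf'
    · rw [map_add, map_add]
      exact hp.add hq
  smul_mem' := by
    rintro c p ⟨⟨f, hf⟩, hp⟩
    refine ⟨⟨c • f, ?_⟩, ?_⟩
    · rw [map_smul]
      exact hf.smul c
    · rw [map_smul, map_smul]
      exact hp.smul c

-- The operator domain is a form core. If `p` is graph-orthogonal to it, test with the `ψ` solving
-- `((P - b A x)² + 1) ψ = p`: the graph inner product of `p` with `ψ` equals `‖p‖²` in `L²`, so `p
-- = 0`.
open GraphSpace in
lemma HasMagGrad.mem_closure {b : ℝ} {u : L2} {g : L2Vec} (h : HasMagGrad b u g) :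
    mk (u, g) ∈ closure (landauFormSpace b : Set GraphSpace) := by
  refine mem_closure_of_forall_inner_eq_zero (isClosed_formSpace b (K := ⊤) isClosed_univ)
    (fun p hp hD => ?_) (fun p (hp : _ ∧ _) => mem_formSpace.2 ⟨trivial, hp.2⟩)
    (mem_formSpace.2 ⟨trivial, h⟩)
  have hpg := (mem_formSpace.1 hp).2
  obtain ⟨ψ, k, hk, hkf⟩ := exists_landau_add_self_eq b (fst p)
  obtain ⟨gψ, hgψ, -⟩ := id hk
  have h1 := hD (mk (ψ, gψ)) ⟨⟨k, hk⟩, hgψ⟩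
  rw [inner_eq] at h1
  simp only [fst_mk, snd_mk] at h1
  rw [hk.inner_eq hgψ hpg, ← inner_add_right, add_comm, hkf, inner_self_eq_zero] at h1
  rw [h1] at hpg
  exact eq_zero h1 (magGradGraph_functional b (0, _) hpg rfl)

open GraphSpace in
/-- A closed condition on the form domain that holds on the operator domain holds everywhere. -/
lemma HasMagGrad.of_hasLandau {b : ℝ} {F : L2 × L2Vec → ℝ} (hF : Continuous F)
    (h : ∀ ψ f g, HasLandau b ψ f → HasMagGrad b ψ g → 0 ≤ F (ψ, g)) {u : L2} {g : L2Vec}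
    (hu : HasMagGrad b u g) : 0 ≤ F (u, g) := by
  have hc : IsClosed {p : GraphSpace | 0 ≤ F (fst p, snd p)} :=
    isClosed_le continuous_const (hF.comp (fst.continuous.prodMk snd.continuous))
  have hs : (landauFormSpace b : Set GraphSpace) ⊆ {p : GraphSpace | 0 ≤ F (fst p, snd p)} :=
    fun p hp => by
      obtain ⟨⟨f, hf⟩, hp⟩ := hp
      exact h _ _ _ hf hp
  exact closure_minimal hs hc hu.mem_closure

/-! ### Ground states -/

/-- The energy form of `(P - b A x)² + W`, given `ψ` and `g = (P - b A x) ψ`. -/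
def energy (W : Plane → ℝ) (ψ : L2) (g : L2Vec) : ℝ := ‖g‖ ^ 2 + ∫ x, W x * ‖ψ x‖ ^ 2

lemma IsGroundState.exists_hasLandau {b : ℝ} {W : Plane → ℝ} (hW : IsBddMeas W) {e : ℝ} {φ : L2}
    (h : IsGroundState (schrodinger b W) e φ) :
    ∃ f, HasLandau b φ f ∧ f + rmul W hW φ = (e : ℂ) • φ := by
  obtain ⟨-, ⟨hφ, he⟩, -⟩ := h
  obtain ⟨f, hf, hf'⟩ := schrodinger_apply hW ⟨φ, hφ⟩
  exact ⟨f, hf, by rw [← he, hf']⟩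

lemma IsGroundState.energy_eq {b : ℝ} {W : Plane → ℝ} (hW : IsBddMeas W) {e : ℝ} {φ : L2}
    (h : IsGroundState (schrodinger b W) e φ) {g : L2Vec} (hg : HasMagGrad b φ g) :
    energy W φ g = e := by
  obtain ⟨f, hf, hf'⟩ := h.exists_hasLandau hW
  have h1 := hf.inner_self_eq hW hg
  rw [hf', inner_smul_right, inner_self_eq_norm_sq_to_K, h.1] at h1
  simp only [RCLike.ofReal_one, one_pow, mul_one] at h1
  exact (Complex.ofReal_injective h1).symm

/-- The spectral gap, in the form sense. -/
lemma IsGroundState.gap_le_energy {b : ℝ} {W : Plane → ℝ} (hW : IsBddMeas W) {e c : ℝ} {φ : L2}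
    (h : IsGroundState (schrodinger b W) e φ)
    (hgap : ∀ ψ : (schrodinger b W).domain, inner ℂ φ (ψ : L2) = 0 →
        c * ‖ψ‖ ^ 2 ≤ (inner ℂ (ψ : L2) (shift (schrodinger b W) e ψ)).re)
    {u : L2} {g : L2Vec} (hu : HasMagGrad b u g) :
    c * (‖u‖ ^ 2 - ‖(inner ℂ φ u : ℂ)‖ ^ 2) ≤ energy W u g - e * ‖u‖ ^ 2 := by
  -- The difference of the two sides is continuous in the graph norm, so it need only be nonnegative
  -- on the operator domain.
  let F : L2 × L2Vec → ℝ := fun p => ‖p.2‖ ^ 2 + (inner ℂ p.1 (rmul W hW p.1)).re - e * ‖p.1‖ ^ 2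
    - c * (‖p.1‖ ^ 2 - ‖(inner ℂ φ p.1 : ℂ)‖ ^ 2)
  have hF : Continuous F := by
    have h1 : Continuous fun p : L2 × L2Vec => (inner ℂ p.1 (rmul W hW p.1)).re :=
      Complex.continuous_re.comp
        (continuous_fst.inner ((rmul W hW).continuous.comp continuous_fst))
    have h2 : Continuous fun p : L2 × L2Vec => (inner ℂ φ p.1 : ℂ) :=
      continuous_const.inner continuous_fst
    fun_prop
  have key := HasMagGrad.of_hasLandau hF ?_ hu
  · simp only [F, inner_rmul_self, Complex.ofReal_re] at key
    rw [energy]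
    linarith
  · clear hu hF u g
    intro ψ f g hf hg
    obtain ⟨k, hk, hk'⟩ := h.exists_hasLandau hW
    obtain ⟨gφ, hgφ, -⟩ := id hk
    -- The gap hypothesis is applied to `ψ - α φ`, the part of `ψ` orthogonal to the ground state.
    set α : ℂ := inner ℂ φ ψ with hα
    obtain ⟨hd, he⟩ := (hf.add (hk.smul (-α))).exists_schrodinger_eq hW
    have hφφ : inner ℂ φ φ = (1 : ℂ) := by
      rw [inner_self_eq_norm_sq_to_K, h.1]; simp
    have h0 : inner ℂ φ (ψ + (-α) • φ) = 0 := by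
      rw [inner_add_right, inner_smul_right, hφφ, ← hα]; ring
    have h1 := hgap ⟨_, hd⟩ h0
    change c * ‖ψ + (-α) • φ‖ ^ 2 ≤ (inner ℂ (ψ + (-α) • φ)
      (schrodinger b W ⟨_, hd⟩ - (e : ℂ) • (ψ + (-α) • φ))).re at h1
    have h2 : schrodinger b W ⟨_, hd⟩ - (e : ℂ) • (ψ + (-α) • φ)
        = f + rmul W hW ψ - (e : ℂ) • ψ := by
      rw [he, map_add, map_smul, smul_add]
      have : (-α) • k + (-α) • rmul W hW φ = (e : ℂ) • (-α) • φ := by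
        rw [← smul_add, hk', smul_comm]
      rw [← this]
      abel
    -- By symmetry of the operator its range after subtracting `e` is orthogonal to `φ`; subtracting
    -- `α φ` therefore does not change the form.
    have h3 : inner ℂ φ (f + rmul W hW ψ - (e : ℂ) • ψ) = 0 := by
      have : inner ℂ φ f = inner ℂ k ψ := by
        rw [← hf.inner_eq hg hgφ, ← inner_conj_symm k ψ, ← hk.inner_eq hgφ hg, inner_conj_symm]
      rw [inner_sub_right, inner_add_right, this, inner_rmul_right, ← inner_add_left, hk',
        inner_smul_left, inner_smul_right, Complex.conj_ofReal, sub_self]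
    rw [h2, inner_add_left, inner_smul_left, h3, mul_zero, add_zero, inner_sub_right,
      hf.inner_self_eq hW hg, inner_smul_right, inner_self_eq_norm_sq_to_K] at h1
    have h4 : ‖ψ + (-α) • φ‖ ^ 2 = ‖ψ‖ ^ 2 - ‖α‖ ^ 2 := by
      have h5 : ‖ψ‖ ^ 2 = ‖(ψ + (-α) • φ) + α • φ‖ ^ 2 := by
        congr 2; rw [neg_smul]; abel
      rw [h5, sq ‖_ + α • φ‖, norm_add_sq_eq_norm_sq_add_norm_sq_of_inner_eq_zero
        (ψ + (-α) • φ) (α • φ) (by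
          rw [inner_smul_right, ← inner_conj_symm, h0]; simp), norm_smul, h.1]
      ring
    rw [h4, Complex.sub_re, Complex.ofReal_re] at h1
    have h6 : ((e : ℂ) * ((‖ψ‖ : ℝ) : ℂ) ^ 2).re = e * ‖ψ‖ ^ 2 := by norm_cast
    have h7 : c * (‖ψ‖ ^ 2 - ‖α‖ ^ 2) ≤
      (‖g‖ ^ 2 + ∫ x, W x * ‖ψ x‖ ^ 2) - e * ‖ψ‖ ^ 2 := h6 ▸ h1
    simp only [F, inner_rmul_self, Complex.ofReal_re]
    linarith

/-! ### Pairs of cutoffs -/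

/-- The constant `c` admits outer cutoffs, which equal one near infinity. -/
lemma isCutoff_of_hasCompactSupport {χ : Plane → ℝ} {c : ℝ} (h : ContDiff ℝ ∞ χ)
    (hc : HasCompactSupport fun x => χ x - c) : IsCutoff χ := by
  refine ⟨h, ⟨h.continuous.measurable, ?_⟩, fun j => ?_⟩
  · obtain ⟨C, hC⟩ := hc.exists_bound_of_continuous (h.continuous.sub continuous_const)
    refine ⟨C + ‖c‖, fun x => ?_⟩
    calc ‖χ x‖ = ‖(χ x - c) + c‖ := by rw [sub_add_cancel]
      _ ≤ _ := (norm_add_le _ _).trans (add_le_add_left (hC x) _)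
  · have hcont : Continuous (partialDeriv j χ) :=
      (h.continuous_fderiv (by simp)).clm_apply continuous_const
    have hsupp : HasCompactSupport (partialDeriv j χ) := by
      have h1 := hc.fderiv_apply (𝕜 := ℝ) (EuclideanSpace.single j (1 : ℝ))
      simp only [fderiv_sub_const] at h1
      exact h1
    exact ⟨hcont.measurable, hsupp.exists_bound_of_continuous hcont⟩

/-- A smooth quadratic partition of unity `χ² + χ'² = 1` with `χ = 1` on the disc of radius `ρ₁`
about `p` and `χ = 0` off the disc of radius `ρ₂`. -/
structure IsCutoffPair (p : Plane) (ρ₁ ρ₂ : ℝ) (χ χ' : Plane → ℝ) : Prop where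
  left : IsCutoff χ
  right : IsCutoff χ'
  sq_add_sq : ∀ x, χ x ^ 2 + χ' x ^ 2 = 1
  left_nonneg : ∀ x, 0 ≤ χ x
  right_nonneg : ∀ x, 0 ≤ χ' x
  right_eq_zero : ∀ x, ‖x - p‖ ≤ ρ₁ → χ' x = 0
  left_eq_zero : ∀ x, ρ₂ ≤ ‖x - p‖ → χ x = 0

/-- Sine and cosine of `π/2` times a smooth bump keep both functions smooth, whereas `√(1 - χ²)`
might not be. -/
lemma exists_isCutoffPair (p : Plane) {ρ₁ ρ₂ : ℝ} (h1 : 0 < ρ₁) (h2 : ρ₁ < ρ₂) :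
    ∃ χ χ', IsCutoffPair p ρ₁ ρ₂ χ χ' := by
  let f : ContDiffBump p := ⟨ρ₁, ρ₂, h1, h2⟩
  have hf : ContDiff ℝ ∞ fun x => Real.pi / 2 * f x := contDiff_const.mul f.contDiff
  have hf0 : ∀ x, 0 ≤ Real.pi / 2 * f x := fun x => mul_nonneg (by positivity) f.nonneg
  have hf1 : ∀ x, Real.pi / 2 * f x ≤ Real.pi / 2 := fun x =>
    mul_le_of_le_one_right (by positivity) f.le_one
  refine ⟨fun x => Real.sin (Real.pi / 2 * f x), fun x => Real.cos (Real.pi / 2 * f x),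
    ⟨?_, ?_, fun x => Real.sin_sq_add_cos_sq _, fun x => ?_, fun x => ?_, fun x hx => ?_,
      fun x hx => ?_⟩⟩
  · exact isCutoff_of_hasCompactSupport (c := 0) (Real.contDiff_sin.comp hf)
      (f.hasCompactSupport.comp_left (g := fun t => Real.sin (Real.pi / 2 * t) - 0) (by simp))
  · exact isCutoff_of_hasCompactSupport (c := 1) (Real.contDiff_cos.comp hf)
      (f.hasCompactSupport.comp_left (g := fun t => Real.cos (Real.pi / 2 * t) - 1) (by simp))
  · exact Real.sin_nonneg_of_nonneg_of_le_pi (hf0 x) (by linarith [hf1 x, Real.pi_pos])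
  · exact Real.cos_nonneg_of_neg_pi_div_two_le_of_le (by linarith [hf0 x, Real.pi_pos]) (hf1 x)
  · have : f x = 1 := f.one_of_mem_closedBall (by rwa [Metric.mem_closedBall, dist_eq_norm])
    simp [this]
  · have : f x = 0 := f.zero_of_le_dist (by rwa [dist_eq_norm])
    simp [this]

namespace IsCutoffPair

variable {p : Plane} {ρ₁ ρ₂ : ℝ} {χ χ' : Plane → ℝ}

lemma right_le_one (h : IsCutoffPair p ρ₁ ρ₂ χ χ') (x : Plane) : χ' x ≤ 1 := by
  nlinarith [h.sq_add_sq x, sq_nonneg (χ x), h.right_nonneg x]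

lemma le_one (h : IsCutoffPair p ρ₁ ρ₂ χ χ') (x : Plane) : χ x ≤ 1 := by
  nlinarith [h.sq_add_sq x, sq_nonneg (χ' x), h.left_nonneg x]

lemma left_eq_one (h : IsCutoffPair p ρ₁ ρ₂ χ χ') {x : Plane} (hx : χ' x = 0) : χ x = 1 := by
  have h1 := h.sq_add_sq x
  rw [hx] at h1
  nlinarith [h.left_nonneg x]

lemma right_eq_one (h : IsCutoffPair p ρ₁ ρ₂ χ χ') {x : Plane} (hx : χ x = 0) : χ' x = 1 := by
  have h1 := h.sq_add_sq x
  rw [hx] at h1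
  nlinarith [h.right_nonneg x]

/-- Since `0 ≤ χ ≤ 1`, one has `(1 - χ)² ≤ (1 - χ)(1 + χ) = χ'²`. -/
lemma one_sub_sq_le (h : IsCutoffPair p ρ₁ ρ₂ χ χ') (x : Plane) : (χ x - 1) ^ 2 ≤ χ' x ^ 2 := by
  nlinarith [h.sq_add_sq x, h.left_nonneg x, h.le_one x]

/-- A zero of one cutoff is a global minimum of it and a global maximum of the other, so both
gradients vanish. -/
lemma gradSq_eq_zero (h : IsCutoffPair p ρ₁ ρ₂ χ χ') {x : Plane} (hx : χ x = 0 ∨ χ' x = 0) :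
    gradSq χ χ' x = 0 := by
  have e : fderiv ℝ χ x = 0 ∧ fderiv ℝ χ' x = 0 := by
    rcases hx with hx | hx
    · refine ⟨IsLocalMin.fderiv_eq_zero (Eventually.of_forall fun y => ?_),
        IsLocalMax.fderiv_eq_zero (Eventually.of_forall fun y => ?_)⟩
      · simpa only [hx] using h.left_nonneg y
      · simpa only [h.right_eq_one hx] using h.right_le_one y
    · refine ⟨IsLocalMax.fderiv_eq_zero (Eventually.of_forall fun y => ?_),
        IsLocalMin.fderiv_eq_zero (Eventually.of_forall fun y => ?_)⟩
      · simpa only [h.left_eq_one hx] using h.le_one y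
      · simpa only [hx] using h.right_nonneg y
  simp [gradSq, partialDeriv, e.1, e.2]

/-- The localization error is small where the outer cutoff is. -/
lemma exists_gradSq_le (h : IsCutoffPair p ρ₁ ρ₂ χ χ') {η : ℝ} (hη : 0 < η) :
    ∃ C, 0 ≤ C ∧ ∀ x, gradSq χ χ' x ≤ η + C * χ' x ^ 2 := by
  obtain ⟨B, hB⟩ := (isBddMeas_gradSq h.left h.right).bounded
  have hB0 : 0 ≤ B := (norm_nonneg _).trans (hB 0)
  have hcont : Continuous (gradSq χ χ') := by
    have h1 : ∀ j, Continuous (partialDeriv j χ) := fun j =>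
      (h.left.smooth.continuous_fderiv (by simp)).clm_apply continuous_const
    have h2 : ∀ j, Continuous (partialDeriv j χ') := fun j =>
      (h.right.smooth.continuous_fderiv (by simp)).clm_apply continuous_const
    exact continuous_finsetSum _ fun j _ => ((h1 j).pow 2).add ((h2 j).pow 2)
  -- On this compact set the error is positive, so `χ'` has no zero there and `χ'²` has a positive
  -- minimum.
  let K := Metric.closedBall p ρ₂ ∩ {x | η ≤ gradSq χ χ' x}
  have hK : IsCompact K :=
    (isCompact_closedBall p ρ₂).inter_right (isClosed_le continuous_const hcont)
  have hmem : ∀ x, η ≤ gradSq χ χ' x → x ∈ K := by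
    refine fun x hx => ⟨?_, hx⟩
    by_contra hn
    rw [Metric.mem_closedBall, dist_eq_norm, not_le] at hn
    have := h.gradSq_eq_zero (.inl (h.left_eq_zero x hn.le))
    linarith
  rcases K.eq_empty_or_nonempty with he | hne
  · refine ⟨0, le_rfl, fun x => ?_⟩
    by_contra! hx
    have := hmem x (by linarith)
    rw [he] at this
    exact this
  · obtain ⟨y, hy, hmin⟩ := hK.exists_isMinOn hne
      ((h.right.smooth.continuous.pow 2).continuousOn)
    have hm : 0 < χ' y ^ 2 := by
      refine (sq_nonneg _).lt_of_ne' fun h0 => ?_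
      have := h.gradSq_eq_zero (.inr (pow_eq_zero_iff two_ne_zero |>.1 h0))
      have : η ≤ gradSq χ χ' y := hy.2
      linarith
    refine ⟨B / χ' y ^ 2, by positivity, fun x => ?_⟩
    rcases le_or_gt η (gradSq χ χ' x) with hx | hx
    · have h1 : χ' y ^ 2 ≤ χ' x ^ 2 := hmin (hmem x hx)
      have h2 : gradSq χ χ' x ≤ B := (le_abs_self _).trans (hB x)
      have h3 : B ≤ B / χ' y ^ 2 * χ' x ^ 2 := by
        rw [div_mul_eq_mul_div, le_div_iff₀ hm]
        exact mul_le_mul_of_nonneg_left h1 hB0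
      linarith
    · have : 0 ≤ B / χ' y ^ 2 * χ' x ^ 2 := by positivity
      linarith

end IsCutoffPair

/-! ### Magnetic translates are eventually almost orthogonal -/

/-- A compactly supported approximation `θ` within `1/4` has disjoint support from a far translate,
so the overlap is at most `1/4 + (5/4)(1/4) < 1`. -/
lemma exists_norm_inner_magTranslate_lt_one (b : ℝ) {φ : L2} (hφ : ‖φ‖ = 1) :
    ∃ z, ‖(inner ℂ φ (magTranslate b z φ) : ℂ)‖ < 1 := by
  obtain ⟨η, hc, hη, hcont, hM⟩ := (Lp.memLp φ).exists_hasCompactSupport_eLpNorm_sub_le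
    (by norm_num) (ε := ENNReal.ofReal (1 / 4)) (by simp)
  let θ : L2 := hM.toLp η
  have hθ : ‖φ - θ‖ ≤ 1 / 4 := by
    rw [Lp.norm_def]
    refine ENNReal.toReal_le_of_le_ofReal (by norm_num) (le_trans (le_of_eq ?_) hη)
    refine eLpNorm_congr_ae ?_
    filter_upwards [Lp.coeFn_sub φ θ, hM.coeFn_toLp] with x h1 h2
    rw [h1, Pi.sub_apply, Pi.sub_apply, h2]
  have hθ' : ‖θ‖ ≤ 5 / 4 := by
    have := norm_sub_norm_le θ φ
    rw [norm_sub_rev, hφ] at this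
    linarith
  obtain ⟨R, hR⟩ := hc.isCompact.isBounded.subset_closedBall (0 : Plane)
  let z : Plane := EuclideanSpace.single 0 (2 * |R| + 1)
  have hz : ‖z‖ = 2 * |R| + 1 := by
    rw [PiLp.norm_single, Real.norm_of_nonneg (by positivity)]
  have h0 : inner ℂ θ (magTranslate b z θ) = (0 : ℂ) := by
    rw [L2.inner_def, ← integral_zero Plane ℂ]
    refine integral_congr_ae ?_
    filter_upwards [coeFn_magTranslate b z θ, hM.coeFn_toLp, comp_sub_ae hM.coeFn_toLp z]
      with x h1 h2 h3
    rw [h1, h2, translateFun, h3]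
    by_cases hx : η x = 0
    · simp [hx]
    have hx' : η (x - z) = 0 := by
      by_contra hx'
      have e1 := hR (subset_tsupport _ hx)
      have e2 := hR (subset_tsupport _ hx')
      rw [mem_closedBall_zero_iff] at e1 e2
      have e3 : ‖z‖ ≤ ‖x‖ + ‖x - z‖ := by
        have := norm_sub_le x (x - z)
        rwa [sub_sub_cancel] at this
      have := le_abs_self R
      linarith
    simp [hx']
  refine ⟨z, ?_⟩
  have e : inner ℂ φ (magTranslate b z φ) = inner ℂ (φ - θ) (magTranslate b z φ)
      + inner ℂ θ (magTranslate b z (φ - θ)) + (inner ℂ θ (magTranslate b z θ) : ℂ) := by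
    have : magTranslate b z φ = magTranslate b z (φ - θ) + magTranslate b z θ := by
      rw [← magTranslate_add, sub_add_cancel]
    rw [inner_sub_left, add_assoc, ← inner_add_right, ← this, sub_add_cancel]
  rw [e, h0, add_zero]
  have h1 := norm_inner_le_norm (𝕜 := ℂ) (φ - θ) (magTranslate b z φ)
  have h2 := norm_inner_le_norm (𝕜 := ℂ) θ (magTranslate b z (φ - θ))
  rw [norm_magTranslate, hφ, mul_one] at h1
  rw [norm_magTranslate] at h2
  have h3 : ‖θ‖ * ‖φ - θ‖ ≤ 5 / 4 * (1 / 4) := mul_le_mul hθ' hθ (norm_nonneg _) (by norm_num)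
  have h4 := norm_add_le (inner ℂ (φ - θ) (magTranslate b z φ))
    (inner ℂ θ (magTranslate b z (φ - θ)) : ℂ)
  linarith

/-- Without a potential there is no isolated simple ground state. -/
lemma not_isGroundState_of_ae_eq_zero {b : ℝ} {W : Plane → ℝ} (hW : IsBddMeas W)
    (hW0 : W =ᵐ[volume] 0) {e c : ℝ} (hc : 0 < c) {φ : L2}
    (h : IsGroundState (schrodinger b W) e φ)
    (hgap : ∀ ψ : (schrodinger b W).domain, inner ℂ φ (ψ : L2) = 0 →
        c * ‖ψ‖ ^ 2 ≤ (inner ℂ (ψ : L2) (shift (schrodinger b W) e ψ)).re) : False := by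
  obtain ⟨z, hz⟩ := exists_norm_inner_magTranslate_lt_one b h.1
  obtain ⟨f, ⟨g, hg, -⟩, -⟩ := h.exists_hasLandau hW
  have h0 : ∀ u : L2, ∫ x, W x * ‖u x‖ ^ 2 = 0 := by
    intro u
    rw [← integral_zero Plane ℝ]
    refine integral_congr_ae ?_
    filter_upwards [hW0] with x hx
    rw [hx, Pi.zero_apply, zero_mul]
  -- With no potential the translate also has energy `e`, so the gap would force its overlap with
  -- `φ` to have modulus at least one.
  have h1 := h.gap_le_energy hW hgap (hg.magTranslate z)
  have h2 := h.energy_eq hW hg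
  rw [energy, h0] at h1 h2
  rw [norm_magTranslateVec, norm_magTranslate, h.1, ← h2] at h1
  have h3 : ‖(inner ℂ φ (magTranslate b z φ) : ℂ)‖ ^ 2 < 1 := by
    nlinarith [norm_nonneg (inner ℂ φ (magTranslate b z φ) : ℂ)]
  nlinarith

/-! ### An upper bound on the ground state energy -/

/-- Changing the field strength for a compactly supported `η`. -/
lemma hasMagGrad_toLp {η : Plane → ℂ} (hη : ContDiff ℝ ∞ η) (hc : HasCompactSupport η)
    {g₀ : L2Vec}
    (h₀ : HasMagGrad 0 ((hη.continuous.memLp_of_hasCompactSupport (μ := volume) (p := 2) hc).toLp η)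
      g₀)
    (hA : ∀ j, MemLp (fun x => (vecPot x j : ℂ) * η x) 2 volume) (b : ℝ) :
    HasMagGrad b ((hη.continuous.memLp_of_hasCompactSupport (μ := volume) (p := 2) hc).toLp η)
      (g₀ - (b : ℂ) • WithLp.toLp 2 fun j => (hA j).toLp _) := by
  intro j θ hθ hcθ
  have hM := hη.continuous.memLp_of_hasCompactSupport (μ := volume) (p := 2) hc
  have key := h₀ j θ hθ hcθ
  change _ = ∫ x, conj (θ x) * (g₀ j - (b : ℂ) • (hA j).toLp _ : L2) x
  have i1 := integrable_conj_mul (continuous_magMomentum 0 j hθ)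
    (hasCompactSupport_magMomentum 0 j hcθ) (hM.toLp η)
  have i2 := integrable_conj_mul hθ.continuous hcθ (g₀ j)
  have i3 := integrable_conj_mul hθ.continuous hcθ ((hA j).toLp _)
  have e1 : ∫ x, conj (magMomentum b j θ x) * (hM.toLp η : L2) x
      = (∫ x, conj (magMomentum 0 j θ x) * (hM.toLp η : L2) x)
        - b * ∫ x, conj (θ x) * ((hA j).toLp _ : L2) x := by
    rw [← integral_const_mul, ← integral_sub i1 (i3.const_mul _)]
    refine integral_congr_ae ?_
    filter_upwards [hM.coeFn_toLp, (hA j).coeFn_toLp] with x h1 h2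
    rw [h1, h2]
    simp only [magMomentum, map_sub, map_mul, Complex.conj_ofReal]
    push_cast
    ring
  have e2 : ∫ x, conj (θ x) * (g₀ j - (b : ℂ) • (hA j).toLp _ : L2) x
      = (∫ x, conj (θ x) * g₀ j x) - b * ∫ x, conj (θ x) * ((hA j).toLp _ : L2) x := by
    rw [← integral_const_mul, ← integral_sub i2 (i3.const_mul _)]
    refine integral_congr_ae ?_
    filter_upwards [Lp.coeFn_sub (g₀ j) ((b : ℂ) • (hA j).toLp _),
      Lp.coeFn_smul (b : ℂ) ((hA j).toLp _)] with x h1 h2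
    rw [h1, Pi.sub_apply, h2, Pi.smul_apply, smul_eq_mul]
    ring
  rw [e1, e2, key]

/-- Averaging over translates: some translate of a profile `F` sees the mean of the potential. -/
lemma exists_integral_translate_le {v F : Plane → ℝ} {a : ℝ} (ha : 0 < a) (hv : Integrable v)
    (hsupp : tsupport v ⊆ Metric.closedBall 0 a) (hF : Integrable F)
    (hF1 : ∀ x, 1 ≤ ‖x‖ → F x = 0) :
    ∃ z, ∫ x, v x * F (z - x) ≤
      (volume.real (Metric.ball (0 : Plane) (a + 1)))⁻¹ * ((∫ x, v x) * ∫ x, F x) := by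
  let w : Plane → ℝ := fun z => ∫ x, v x * F (z - x)
  -- The convolution has integral `(∫ v)(∫ F)` and vanishes off the ball of radius `a + 1`; on that
  -- ball it is somewhere at most its mean.
  have hw : w = MeasureTheory.convolution v F (ContinuousLinearMap.mul ℝ ℝ) volume := rfl
  have hwi : Integrable w := by
    rw [hw]
    exact hv.integrable_convolution _ hF
  have hint : ∫ z, w z = (∫ x, v x) * ∫ x, F x := by
    rw [hw, integral_convolution _ hv hF]
    rfl
  have h0 : ∀ z, z ∉ Metric.ball (0 : Plane) (a + 1) → w z = 0 := by
    intro z hz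
    rw [mem_ball_zero_iff, not_lt] at hz
    change ∫ x, v x * F (z - x) = 0
    rw [← integral_zero Plane ℝ]
    congr 1
    funext x
    by_cases hx : v x = 0
    · simp [hx]
    have := hsupp (subset_tsupport v hx)
    rw [mem_closedBall_zero_iff] at this
    rw [hF1 _ (by have := norm_sub_norm_le z x; linarith), mul_zero]
  obtain ⟨z, -, hz⟩ := exists_le_setAverage (μ := volume) (s := Metric.ball (0 : Plane) (a + 1))
    (Metric.measure_ball_pos _ _ (by linarith)).ne' measure_ball_lt_top.ne hwi.integrableOn
  refine ⟨z, hz.trans (le_of_eq ?_)⟩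
  rw [setAverage_eq, setIntegral_eq_integral_of_forall_compl_eq_zero h0, hint, smul_eq_mul]

lemma abs_vecPot_le (x : Plane) (j : Fin 2) : |vecPot x j| ≤ ‖x‖ / 2 := by
  have h : ∀ i, |x i| ≤ ‖x‖ := fun i => PiLp.norm_apply_le x i
  fin_cases j
  · simp only [vecPot]
    have := h 1
    simp [abs_div]
    linarith
  · simp only [vecPot]
    have := h 0
    simp [abs_div]
    linarith

/-- For strong fields, the ground state energy of an attractive well is of order `-λ²`. -/
lemma exists_energy_le {v : Plane → ℝ} {a : ℝ} (ha : 0 < a) (hv : Integrable v)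
    (hsupp : tsupport v ⊆ Metric.closedBall 0 a) (hneg : ∫ x, v x < 0) :
    ∃ c > 0, ∃ L > 0, ∀ lam : ℝ, L ≤ lam → ∃ u g, HasMagGrad lam u g ∧ 0 < ‖u‖ ∧
      energy (fun x => lam ^ 2 * v x) u g ≤ -(c * lam ^ 2) * ‖u‖ ^ 2 := by
  have hvol : 0 < volume.real (Metric.ball (0 : Plane) (a + 1)) :=
    ENNReal.toReal_pos (Metric.measure_ball_pos _ _ (by linarith)).ne' measure_ball_lt_top.ne
  obtain ⟨c₀, hc₀, hc₀'⟩ : ∃ c₀ > 0, (volume.real (Metric.ball (0 : Plane) (a + 1)))⁻¹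
      * ∫ x, v x = -c₀ :=
    ⟨_, neg_pos.2 (mul_neg_of_pos_of_neg (inv_pos.2 hvol) hneg), (neg_neg _).symm⟩
  -- `δ` is the radius of the trial bump. The potential gains `c₀ λ²` per unit mass with `c₀`
  -- independent of `δ`, while the gauge term `λ²|A|²` costs at most `λ² δ²/2`, hence at most a
  -- quarter of the gain.
  obtain ⟨δ, hδ0, hδ1, hδ⟩ : ∃ δ : ℝ, 0 < δ ∧ δ ≤ 1 ∧ δ ^ 2 ≤ c₀ / 2 := by
    refine ⟨min 1 (√(c₀ / 2)), lt_min one_pos (Real.sqrt_pos.2 (by linarith)), min_le_left _ _, ?_⟩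
    calc _ ≤ √(c₀ / 2) ^ 2 := pow_le_pow_left₀ (by positivity) (min_le_right _ _) 2
      _ = _ := Real.sq_sqrt (by linarith)
  let f : ContDiffBump (0 : Plane) := ⟨δ / 2, δ, by linarith, by linarith⟩
  let η : Plane → ℂ := fun x => (f x : ℂ)
  have hη : ContDiff ℝ ∞ η := Complex.ofRealCLM.contDiff.comp f.contDiff
  have hcη : HasCompactSupport η :=
    f.hasCompactSupport.comp_left (g := fun t : ℝ => (t : ℂ)) (by simp)
  have hM := hη.continuous.memLp_of_hasCompactSupport (μ := volume) (p := 2) hcη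
  let θ : L2 := hM.toLp η
  have hθx : ∀ᵐ x, ‖(θ : L2) x‖ ^ 2 = f x ^ 2 := by
    filter_upwards [hM.coeFn_toLp] with x hx
    rw [hx, Complex.norm_real, Real.norm_eq_abs, sq_abs]
  have hFc : Continuous fun x => f x ^ 2 := f.continuous.pow 2
  have hFs : HasCompactSupport fun x => f x ^ 2 :=
    f.hasCompactSupport.comp_left (g := fun t : ℝ => t ^ 2) (by simp)
  have hFi : Integrable fun x => f x ^ 2 := hFc.integrable_of_hasCompactSupport hFs
  set N := ∫ x, f x ^ 2 with hN
  have hN0 : 0 < N := hFc.integral_pos_of_hasCompactSupport_nonneg_nonzero hFs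
    (fun x => sq_nonneg _) (x := 0) (by
      rw [f.one_of_mem_closedBall (Metric.mem_closedBall_self (by change 0 ≤ δ / 2; linarith))]
      norm_num)
  have hθN : ‖θ‖ ^ 2 = N := by
    rw [norm_sq_eq_integral]
    exact integral_congr_ae hθx
  have hAc : ∀ j, Continuous fun x => (vecPot x j : ℂ) * η x := fun j =>
    (Complex.continuous_ofReal.comp (continuous_vecPot_apply j)).mul hη.continuous
  have hA : ∀ j, MemLp (fun x => (vecPot x j : ℂ) * η x) 2 volume := fun j =>
    (hAc j).memLp_of_hasCompactSupport hcη.mul_left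
  let A : L2Vec := WithLp.toLp 2 fun j => (hA j).toLp _
  have hAN : ‖A‖ ^ 2 ≤ δ ^ 2 / 2 * N := by
    have hj : ∀ j, ‖A j‖ ^ 2 ≤ δ ^ 2 / 4 * N := by
      intro j
      rw [norm_sq_eq_integral, hN, ← integral_const_mul]
      refine integral_mono_ae (integrable_norm_sq _) (hFi.const_mul _) ?_
      filter_upwards [(hA j).coeFn_toLp] with x hx
      change ‖((hA j).toLp _ : L2) x‖ ^ 2 ≤ δ ^ 2 / 4 * f x ^ 2
      rw [hx, norm_mul, Complex.norm_real, Complex.norm_real, mul_pow, Real.norm_eq_abs,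
        Real.norm_eq_abs, sq_abs (f x)]
      rcases le_or_gt δ ‖x‖ with h | h
      · have : f x = 0 := f.zero_of_le_dist (by rwa [dist_zero_right])
        simp [this]
      · refine mul_le_mul_of_nonneg_right ?_ (sq_nonneg _)
        calc |vecPot x j| ^ 2 ≤ (δ / 2) ^ 2 := pow_le_pow_left₀ (abs_nonneg _)
              ((abs_vecPot_le x j).trans (by linarith)) 2
          _ = _ := by ring
    rw [norm_sq_l2Vec, Fin.sum_univ_two]
    linarith [hj 0, hj 1]
  obtain ⟨z, hz⟩ := exists_integral_translate_le ha hv hsupp hFi fun x hx => by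
    have : f x = 0 := f.zero_of_le_dist (by rw [dist_zero_right]; exact hδ1.trans hx)
    rw [this]; norm_num
  rw [← mul_assoc, hc₀'] at hz
  let g₀ := magGrad 0 ⟨θ, test_mem_domain 0 hη hcη⟩
  have hg₀ : HasMagGrad 0 θ g₀ := hasMagGrad_magGrad 0 ⟨θ, _⟩
  -- The threshold makes the field-free kinetic term `2‖g₀‖²` at most `c₀ λ² N / 4`.
  refine ⟨c₀ / 4, by linarith, √(8 * ‖g₀‖ ^ 2 / (c₀ * N)) + 1, by positivity, fun lam hlam => ?_⟩
  have hg := (hasMagGrad_toLp hη hcη hg₀ hA lam)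
  -- The magnetic translation moves the bump to `z` without changing its kinetic energy, so `A` is
  -- only felt at distance `δ` from the origin.
  refine ⟨_, _, hg.magTranslate z, ?_, ?_⟩
  · rw [norm_magTranslate]
    exact (norm_nonneg _).lt_of_ne' fun h0 => by
      rw [show ‖θ‖ = 0 from h0] at hθN
      simp at hθN
      linarith
  · have hpot : ∫ x, lam ^ 2 * v x * ‖magTranslate lam z θ x‖ ^ 2 ≤ lam ^ 2 * (-c₀ * N) := by
      rw [integral_weight_magTranslate]
      have : ∫ x, lam ^ 2 * v (x + z) * ‖(θ : L2) x‖ ^ 2 = lam ^ 2 * ∫ x, v x * f (z - x) ^ 2 := by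
        rw [← integral_const_mul, ← integral_add_right_eq_self
          (fun x => lam ^ 2 * (v x * f (z - x) ^ 2)) z]
        refine integral_congr_ae ?_
        filter_upwards [hθx] with x hx
        rw [hx, sub_add_cancel_right, f.neg]
        ring
      rw [this]
      exact mul_le_mul_of_nonneg_left hz (sq_nonneg _)
    have hkin : ‖g₀ - (lam : ℂ) • A‖ ^ 2 ≤ 2 * ‖g₀‖ ^ 2 + 2 * (lam ^ 2 * ‖A‖ ^ 2) := by
      have h1 := norm_sub_le g₀ ((lam : ℂ) • A)
      rw [norm_smul, Complex.norm_real, Real.norm_eq_abs] at h1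
      have h2 : (|lam| * ‖A‖) ^ 2 = lam ^ 2 * ‖A‖ ^ 2 := by rw [mul_pow, sq_abs]
      rw [← h2]
      nlinarith [sq_nonneg (‖g₀‖ - |lam| * ‖A‖), norm_nonneg (g₀ - (lam : ℂ) • A)]
    have hlam2 : 8 * ‖g₀‖ ^ 2 ≤ lam ^ 2 * (c₀ * N) := by
      rw [← div_le_iff₀ (by positivity)]
      exact (Real.sqrt_le_left (by linarith [Real.sqrt_nonneg (8 * ‖g₀‖ ^ 2 / (c₀ * N))])).1
        (by linarith)
    rw [energy, norm_magTranslateVec, norm_magTranslate, show ‖_‖ ^ 2 = N from hθN]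
    have h3 : lam ^ 2 * ‖A‖ ^ 2 ≤ lam ^ 2 * (c₀ / 4 * N) := by
      refine mul_le_mul_of_nonneg_left (hAN.trans ?_) (sq_nonneg _)
      exact mul_le_mul_of_nonneg_right (by linarith) hN0.le
    have h4 : ‖g₀ - (lam : ℂ) • A‖ ^ 2 + ∫ x, lam ^ 2 * v x * ‖magTranslate lam z θ x‖ ^ 2
        ≤ -(c₀ / 4 * lam ^ 2) * N := by nlinarith
    exact h4

/-! ### Localization of the energy -/

lemma integral_weight_rmul {w : Plane → ℝ} (h : IsBddMeas w) (W : Plane → ℝ) (ψ : L2) :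
    ∫ x, W x * ‖rmul w h ψ x‖ ^ 2 = ∫ x, W x * w x ^ 2 * ‖ψ x‖ ^ 2 := by
  refine integral_congr_ae ?_
  filter_upwards [coeFn_rmul h ψ] with x hx
  rw [hx, norm_mul, Complex.norm_real, mul_pow, Real.norm_eq_abs, sq_abs, mul_assoc]

lemma energy_congr_rmul {w : Plane → ℝ} (h : IsBddMeas w) {W W' : Plane → ℝ}
    (hW : ∀ x, w x ≠ 0 → W x = W' x) (ψ : L2) (g : L2Vec) :
    energy W (rmul w h ψ) g = energy W' (rmul w h ψ) g := by
  rw [energy, energy, integral_weight_rmul, integral_weight_rmul]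
  congr 2
  funext x
  by_cases hx : w x = 0
  · simp [hx]
  · rw [hW x hx]

lemma energy_zero_nonneg (ψ : L2) (g : L2Vec) : 0 ≤ energy 0 ψ g := by
  simp only [energy, Pi.zero_apply, zero_mul, integral_zero, add_zero]
  positivity

lemma integral_weight_mono {w w' : Plane → ℝ} (h : IsBddMeas w) (h' : IsBddMeas w')
    (hle : ∀ x, w x ≤ w' x) (ψ : L2) :
    ∫ x, w x * ‖ψ x‖ ^ 2 ≤ ∫ x, w' x * ‖ψ x‖ ^ 2 :=
  integral_mono (h.integrable_mul_norm_sq ψ) (h'.integrable_mul_norm_sq ψ) fun x =>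
    mul_le_mul_of_nonneg_right (hle x) (sq_nonneg _)

lemma integral_add_const_mul_sq {w : Plane → ℝ} (h : IsBddMeas w) (η C : ℝ) (ψ : L2) :
    ∫ x, (η + C * w x ^ 2) * ‖ψ x‖ ^ 2 = η * ‖ψ‖ ^ 2 + C * ‖rmul w h ψ‖ ^ 2 := by
  rw [norm_sq_rmul, norm_sq_eq_integral ψ, ← integral_const_mul, ← integral_const_mul,
    ← integral_add ((integrable_norm_sq ψ).const_mul _)
      ((h.sq.integrable_mul_norm_sq ψ).const_mul _)]
  congr 1
  funext x
  ring

lemma integral_le_of_le_add_const_mul_sq {w u : Plane → ℝ} (h : IsBddMeas w) (hu : IsBddMeas u)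
    {η C : ℝ} (hle : ∀ x, u x ≤ η + C * w x ^ 2) (ψ : L2) :
    ∫ x, u x * ‖ψ x‖ ^ 2 ≤ η * ‖ψ‖ ^ 2 + C * ‖rmul w h ψ‖ ^ 2 := by
  rw [← integral_add_const_mul_sq]
  exact integral_weight_mono hu ((isBddMeas_const η).add (h.sq.const_mul C)) hle ψ

lemma rmul_rmul {w w' : Plane → ℝ} (h : IsBddMeas w) (h' : IsBddMeas w') (ψ : L2) :
    rmul w h (rmul w' h' ψ) = rmul _ (h.mul h') ψ := by
  ext1
  filter_upwards [coeFn_rmul h (rmul w' h' ψ), coeFn_rmul h' ψ, coeFn_rmul (h.mul h') ψ]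
    with x h1 h2 h3
  rw [h1, h2, h3]
  push_cast
  ring

lemma rmul_congr {w w' : Plane → ℝ} (h : IsBddMeas w) (h' : IsBddMeas w') (e : ∀ x, w x = w' x)
    (ψ : L2) : rmul w h ψ = rmul w' h' ψ := by
  obtain rfl : w = w' := funext e
  rfl

namespace IsCutoffPair

variable {p : Plane} {ρ₁ ρ₂ : ℝ} {χ χ' : Plane → ℝ}

lemma norm_sq_eq (h : IsCutoffPair p ρ₁ ρ₂ χ χ') (ψ : L2) :
    ‖ψ‖ ^ 2 = ‖rmul χ h.left.bdd ψ‖ ^ 2 + ‖rmul χ' h.right.bdd ψ‖ ^ 2 := by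
  rw [norm_sq_rmul, norm_sq_rmul, ← integral_add (h.left.bdd.sq.integrable_mul_norm_sq ψ)
    (h.right.bdd.sq.integrable_mul_norm_sq ψ), norm_sq_eq_integral]
  congr 1
  funext x
  rw [← add_mul, h.sq_add_sq, one_mul]

lemma energy_eq (h : IsCutoffPair p ρ₁ ρ₂ χ χ') {W : Plane → ℝ} (hW : IsBddMeas W) (ψ : L2)
    (g : L2Vec) :
    energy W ψ g = energy W (rmul χ h.left.bdd ψ) (mulGrad χ h.left ψ g)
      + energy W (rmul χ' h.right.bdd ψ) (mulGrad χ' h.right ψ g)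
      - ∫ x, gradSq χ χ' x * ‖ψ x‖ ^ 2 := by
  have h1 := norm_sq_eq_localization h.left h.right h.sq_add_sq ψ g
  have h2 : ∫ x, W x * ‖ψ x‖ ^ 2 = (∫ x, W x * ‖rmul χ h.left.bdd ψ x‖ ^ 2)
      + ∫ x, W x * ‖rmul χ' h.right.bdd ψ x‖ ^ 2 := by
    rw [integral_weight_rmul, integral_weight_rmul,
      ← integral_add ((hW.mul h.left.bdd.sq).integrable_mul_norm_sq ψ)
        ((hW.mul h.right.bdd.sq).integrable_mul_norm_sq ψ)]
    congr 1
    funext x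
    rw [← add_mul, ← mul_add, h.sq_add_sq, mul_one]
  simp only [energy]
  rw [h1, h2]
  ring

lemma norm_rmul_sub_le (h : IsCutoffPair p ρ₁ ρ₂ χ χ') (ψ : L2) :
    ‖rmul χ h.left.bdd ψ - ψ‖ ≤ ‖rmul χ' h.right.bdd ψ‖ := by
  refine Lp.norm_le_norm_of_ae_le ?_
  filter_upwards [coeFn_rmul h.left.bdd ψ, coeFn_rmul h.right.bdd ψ,
    Lp.coeFn_sub (rmul χ h.left.bdd ψ) ψ] with x h1 h2 h3
  rw [h3, Pi.sub_apply, h1, h2, norm_mul]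
  have e : (χ x : ℂ) * ψ x - ψ x = ((χ x - 1 : ℝ) : ℂ) * ψ x := by push_cast; ring
  rw [e, norm_mul, Complex.norm_real, Complex.norm_real]
  exact mul_le_mul_of_nonneg_right (sq_le_sq.1 (h.one_sub_sq_le x)) (norm_nonneg _)

end IsCutoffPair

/-! ### States with a spectral gap -/

/-- `φ` is a normalized state of energy `e` in the potential `W`, with a gap `c` in the sense of
quadratic forms. -/
structure IsGappedState (b : ℝ) (W : Plane → ℝ) (e c : ℝ) (φ : L2) : Prop where
  norm_eq_one : ‖φ‖ = 1
  energy_eq : ∃ g, HasMagGrad b φ g ∧ energy W φ g = e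
  gap : ∀ u g, HasMagGrad b u g →
    c * (‖u‖ ^ 2 - ‖(inner ℂ φ u : ℂ)‖ ^ 2) ≤ energy W u g - e * ‖u‖ ^ 2

namespace IsGappedState

variable {b : ℝ} {W : Plane → ℝ} {e c : ℝ} {φ : L2}

lemma of_isGroundState (hW : IsBddMeas W) (h : IsGroundState (schrodinger b W) e φ)
    (hgap : ∀ ψ : (schrodinger b W).domain, inner ℂ φ (ψ : L2) = 0 →
        c * ‖ψ‖ ^ 2 ≤ (inner ℂ (ψ : L2) (shift (schrodinger b W) e ψ)).re) :
    IsGappedState b W e c φ := by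
  obtain ⟨f, ⟨g, hg, -⟩, -⟩ := h.exists_hasLandau hW
  exact ⟨h.1, ⟨g, hg, h.energy_eq hW hg⟩, fun u g hu => h.gap_le_energy hW hgap hu⟩

lemma magTranslate (h : IsGappedState b W e c φ) (z : Plane) :
    IsGappedState b (fun x => W (x - z)) e c (magTranslate b z φ) := by
  have key : ∀ (ψ : L2) (g : L2Vec), energy (fun x => W (x - z))
      (MagneticDoubleWell.magTranslate b z ψ) (magTranslateVec b z g) = energy W ψ g := by
    intro ψ g
    rw [energy, energy, norm_magTranslateVec, integral_weight_magTranslate b z fun x => W (x - z)]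
    simp only [add_sub_cancel_right]
  refine ⟨by rw [norm_magTranslate, h.norm_eq_one], ?_, fun u g hu => ?_⟩
  · obtain ⟨g, hg, he⟩ := h.energy_eq
    exact ⟨_, hg.magTranslate z, by rw [key, he]⟩
  · have h1 := h.gap _ _ (hu.magTranslate (-z))
    have h2 : MagneticDoubleWell.magTranslate b z (MagneticDoubleWell.magTranslate b (-z) u) = u := by
      simpa using magTranslate_neg_magTranslate b (-z) u
    have h3 : magTranslateVec b z (magTranslateVec b (-z) g) = g := by
      ext1 j
      have := magTranslate_neg_magTranslate b (-z) (g j)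
      rw [neg_neg] at this
      exact this
    rw [← key, h2, h3, norm_magTranslate, inner_magTranslate_right, neg_neg] at h1
    exact h1

lemma le_energy (h : IsGappedState b W e c φ) (hc : 0 ≤ c) {u : L2} {g : L2Vec}
    (hu : HasMagGrad b u g) : e * ‖u‖ ^ 2 ≤ energy W u g := by
  have h1 := h.gap u g hu
  have h2 := norm_inner_le_norm (𝕜 := ℂ) φ u
  rw [h.norm_eq_one, one_mul] at h2
  have h3 : ‖(inner ℂ φ u : ℂ)‖ ^ 2 ≤ ‖u‖ ^ 2 := pow_le_pow_left₀ (norm_nonneg _) h2 2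
  have h4 := mul_nonneg hc (sub_nonneg.2 h3)
  linarith

variable {p : Plane} {ρ₁ ρ₂ : ℝ} {χ χ' : Plane → ℝ} {B : ℝ}

/-- The state is concentrated in the well. -/
lemma tail_le (h : IsGappedState b W e c φ) (hc : 0 ≤ c) (hW : IsBddMeas W)
    (hχ : IsCutoffPair p ρ₁ ρ₂ χ χ') (hWχ : ∀ x, χ' x ≠ 0 → W x = 0)
    (hB : ∀ x, gradSq χ χ' x ≤ B) : -e * ‖rmul χ' hχ.right.bdd φ‖ ^ 2 ≤ B := by
  obtain ⟨g, hg, he⟩ := h.energy_eq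
  have h1 := hχ.energy_eq hW φ g
  -- The inner piece has energy at least `e` times its mass and the outer piece at least zero. As
  -- the total is `e`, the missing amount `-e ‖χ' φ‖²` is bounded by the localization error.
  have h2 := h.le_energy hc (hg.mul hχ.left)
  have h3 := energy_zero_nonneg (rmul χ' hχ.right.bdd φ) (mulGrad χ' hχ.right φ g)
  rw [← energy_congr_rmul hχ.right.bdd (W := W) (W' := 0) hWχ] at h3
  have h4 := hχ.norm_sq_eq φ
  have h5 := integral_weight_mono (isBddMeas_gradSq hχ.left hχ.right) (isBddMeas_const B) hB φ
  rw [integral_const_mul, ← norm_sq_eq_integral, h.norm_eq_one] at h5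
  rw [h.norm_eq_one] at h4
  rw [he] at h1
  have h6 : e * 1 ^ 2 = e * ‖rmul χ hχ.left.bdd φ‖ ^ 2 + e * ‖rmul χ' hχ.right.bdd φ‖ ^ 2 := by
    rw [h4, mul_add]
  linarith

/-- The gap for localized functions orthogonal to the state before the localization. -/
lemma gap_localized (h : IsGappedState b W e c φ) (hc : 0 ≤ c) (hW : IsBddMeas W)
    (hχ : IsCutoffPair p ρ₁ ρ₂ χ χ') (hWχ : ∀ x, χ' x ≠ 0 → W x = 0)
    (hB : ∀ x, gradSq χ χ' x ≤ B) {m : ℝ} (hm : 0 < m) (hme : m ≤ -e) {ψ : L2} {g : L2Vec}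
    (hg : HasMagGrad b ψ g) (hψ : inner ℂ φ ψ = (0 : ℂ)) :
    c * (‖rmul χ hχ.left.bdd ψ‖ ^ 2 - B / m * ‖ψ‖ ^ 2) ≤
      energy W (rmul χ hχ.left.bdd ψ) (mulGrad χ hχ.left ψ g)
        - e * ‖rmul χ hχ.left.bdd ψ‖ ^ 2 := by
  refine le_trans (mul_le_mul_of_nonneg_left ?_ hc) (h.gap _ _ (hg.mul hχ.left))
  refine sub_le_sub_left ?_ _
  -- Because `ψ ⊥ φ`, the overlap only sees `(χ - 1) φ`, which is controlled by the tail of `φ`.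
  have h1 : inner ℂ φ (rmul χ hχ.left.bdd ψ) = (inner ℂ (rmul χ hχ.left.bdd φ - φ) ψ : ℂ) := by
    rw [inner_sub_left, hψ, sub_zero, inner_rmul_right]
  have h2 : ‖rmul χ' hχ.right.bdd φ‖ ^ 2 ≤ B / m := by
    rw [le_div_iff₀ hm]
    have := h.tail_le hc hW hχ hWχ hB
    nlinarith [sq_nonneg ‖rmul χ' hχ.right.bdd φ‖]
  have h3 := norm_inner_le_norm (𝕜 := ℂ) (rmul χ hχ.left.bdd φ - φ) ψ
  rw [h1]
  calc _ ≤ (‖rmul χ hχ.left.bdd φ - φ‖ * ‖ψ‖) ^ 2 := pow_le_pow_left₀ (norm_nonneg _) h3 2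
    _ = ‖rmul χ hχ.left.bdd φ - φ‖ ^ 2 * ‖ψ‖ ^ 2 := mul_pow _ _ _
    _ ≤ ‖rmul χ' hχ.right.bdd φ‖ ^ 2 * ‖ψ‖ ^ 2 := by
      gcongr
      exact hχ.norm_rmul_sub_le φ
    _ ≤ _ := by gcongr

end IsGappedState

/-! ### The energy estimate for the double well -/

/-- Two gapped states in potentials of disjoint support: coercivity of the energy on the orthogonal
complement of both, when the wells are deep. -/
lemma energy_ge_of_two_wells {b e c : ℝ} {W₁ W₂ : Plane → ℝ} (hW₁ : IsBddMeas W₁)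
    (hW₂ : IsBddMeas W₂) {φ₁ φ₂ : L2} (h₁ : IsGappedState b W₁ e c φ₁)
    (h₂ : IsGappedState b W₂ e c φ₂) (hc : 0 < c) {p₁ p₂ : Plane} {ρ₁ ρ₂ : ℝ}
    {χ₁ χ₁' χ₂ χ₂' : Plane → ℝ}
    (hχ₁ : IsCutoffPair p₁ ρ₁ ρ₂ χ₁ χ₁') (hχ₂ : IsCutoffPair p₂ ρ₁ ρ₂ χ₂ χ₂')
    (hWχ₁ : ∀ x, χ₁' x ≠ 0 → W₁ x = 0) (hWχ₂ : ∀ x, χ₂' x ≠ 0 → W₂ x = 0)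
    (hdisj : ∀ x, χ₁ x = 0 ∨ χ₂ x = 0) {C : ℝ} (hC : 0 ≤ C)
    (hg₁ : ∀ x, gradSq χ₁ χ₁' x ≤ c / 8 + C * χ₁' x ^ 2)
    (hg₂ : ∀ x, gradSq χ₂ χ₂' x ≤ c / 8 + C * χ₂' x ^ 2)
    {m : ℝ} (hm : 2 * C + c ≤ m) (hm' : 8 * (c / 8 + C) ≤ m) (hme : m ≤ -e)
    {ψ : L2} {g : L2Vec} (hg : HasMagGrad b ψ g) (hψ₁ : inner ℂ φ₁ ψ = (0 : ℂ))
    (hψ₂ : inner ℂ φ₂ ψ = (0 : ℂ)) :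
    c / 2 * ‖ψ‖ ^ 2 ≤ energy (fun x => W₁ x + W₂ x) ψ g - e * ‖ψ‖ ^ 2 := by
  have hm0 : 0 < m := by linarith
  -- Cutting `χ₁' ψ` around the second well gives `χ₂ ψ` itself. This matters because `ψ` is
  -- orthogonal to `φ₂`, whereas `χ₁' ψ` need not be.
  have hχ₁χ₂ : ∀ x, χ₂ x * χ₁' x = χ₂ x := by
    intro x
    rcases hdisj x with h | h
    · rw [hχ₁.right_eq_one h, mul_one]
    · rw [h, zero_mul]
  have hW₁χ₂ : ∀ x, χ₂ x ≠ 0 → W₁ x = 0 := by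
    intro x hx
    refine hWχ₁ x ?_
    rw [hχ₁.right_eq_one ((hdisj x).resolve_right hx)]
    exact one_ne_zero
  have hW₂χ₁ : ∀ x, χ₁ x ≠ 0 → W₂ x = 0 := by
    intro x hx
    refine hWχ₂ x ?_
    rw [hχ₂.right_eq_one ((hdisj x).resolve_left hx)]
    exact one_ne_zero
  have hWb : IsBddMeas fun x => W₁ x + W₂ x := hW₁.add hW₂
  set ψ' := rmul χ₁' hχ₁.right.bdd ψ with hψ'
  set g' := mulGrad χ₁' hχ₁.right ψ g with hg'
  have hgψ' : HasMagGrad b ψ' g' := hg.mul hχ₁.right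
  have hB : ∀ {χ χ' : Plane → ℝ} {p : Plane}, IsCutoffPair p ρ₁ ρ₂ χ χ' →
      (∀ x, gradSq χ χ' x ≤ c / 8 + C * χ' x ^ 2) → ∀ x, gradSq χ χ' x ≤ c / 8 + C := by
    intro χ χ' p h hle x
    refine (hle x).trans (add_le_add_right (mul_le_of_le_one_right hC ?_) _)
    exact pow_le_one₀ (h.right_nonneg x) (h.right_le_one x)
  have hBm : (c / 8 + C) / m ≤ 1 / 8 := by
    rw [div_le_iff₀ hm0]
    linarith
  -- the two wells
  have hrm : rmul χ₂ hχ₂.left.bdd ψ' = rmul χ₂ hχ₂.left.bdd ψ := by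
    rw [hψ', rmul_rmul]
    exact rmul_congr _ _ hχ₁χ₂ ψ
  have a₁ := h₁.gap_localized hc.le hW₁ hχ₁ hWχ₁ (hB hχ₁ hg₁) hm0 hme hg hψ₁
  have a₂ := h₂.gap_localized hc.le hW₂ hχ₂ hWχ₂ (hB hχ₂ hg₂) hm0 hme hg hψ₂
  have hgrad : mulGrad χ₂ hχ₂.left ψ' g' = mulGrad χ₂ hχ₂.left ψ g :=
    (hrm ▸ hgψ'.mul hχ₂.left).unique (hg.mul hχ₂.left)
  rw [← energy_congr_rmul hχ₁.left.bdd (W := fun x => W₁ x + W₂ x)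
    (fun x hx => by rw [hW₂χ₁ x hx, add_zero])] at a₁
  rw [← energy_congr_rmul hχ₂.left.bdd (W := fun x => W₁ x + W₂ x)
    (fun x hx => by rw [hW₁χ₂ x hx, zero_add]), ← hgrad, ← hrm] at a₂
  -- the region between the wells
  have a₃ : 0 ≤ energy (fun x => W₁ x + W₂ x) (rmul χ₂' hχ₂.right.bdd ψ')
      (mulGrad χ₂' hχ₂.right ψ' g') := by
    have := energy_zero_nonneg (rmul χ₂' hχ₂.right.bdd ψ') (mulGrad χ₂' hχ₂.right ψ' g')
    rw [hψ', rmul_rmul] at this ⊢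
    rwa [energy_congr_rmul _ (W := fun x => W₁ x + W₂ x) (W' := 0) fun x hx => by
      rw [hWχ₁ x (right_ne_zero_of_mul hx), hWχ₂ x (left_ne_zero_of_mul hx), add_zero]; rfl]
  -- localization
  have l₁ := hχ₁.energy_eq hWb ψ g
  have l₂ := hχ₂.energy_eq hWb ψ' g'
  have n₁ := hχ₁.norm_sq_eq ψ
  have n₂ := hχ₂.norm_sq_eq ψ'
  -- The first error is charged to the outermost piece `χ₂' χ₁' ψ` and not merely to `χ₁' ψ`: it
  -- vanishes where `χ₁` does, and elsewhere `χ₂' = 1`.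
  have e₁ : ∫ x, gradSq χ₁ χ₁' x * ‖ψ x‖ ^ 2
      ≤ c / 8 * ‖ψ‖ ^ 2 + C * ‖rmul χ₂' hχ₂.right.bdd ψ'‖ ^ 2 := by
    rw [hψ', rmul_rmul]
    refine integral_le_of_le_add_const_mul_sq _ (isBddMeas_gradSq hχ₁.left hχ₁.right) (fun x => ?_) ψ
    rcases hdisj x with h | h
    · rw [hχ₁.gradSq_eq_zero (.inl h)]
      positivity
    · rw [hχ₂.right_eq_one h, one_mul]
      exact hg₁ x
  have e₂ := integral_le_of_le_add_const_mul_sq hχ₂.right.bdd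
    (isBddMeas_gradSq hχ₂.left hχ₂.right) hg₂ ψ'
  have t := mul_le_mul_of_nonneg_right hBm (sq_nonneg ‖ψ‖)
  -- Of the cost `-e` of the outermost piece, `2C` absorbs both localization errors and `c` matches
  -- the gap on the other pieces. The remaining losses are four times `c/8`: two overlaps and two
  -- errors.
  have s := mul_nonneg (show 0 ≤ -e - (2 * C + c) by linarith)
    (sq_nonneg ‖rmul χ₂' hχ₂.right.bdd ψ'‖)
  rw [← hψ'] at l₁ n₁
  rw [← hg'] at l₁
  have q₀ : ‖ψ'‖ ^ 2 ≤ ‖ψ‖ ^ 2 := by linarith [sq_nonneg ‖rmul χ₁ hχ₁.left.bdd ψ‖]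
  generalize ‖rmul χ₂' hχ₂.right.bdd ψ'‖ ^ 2 = N₃ at *
  generalize ‖rmul χ₂ hχ₂.left.bdd ψ'‖ ^ 2 = N₂ at *
  generalize ‖rmul χ₁ hχ₁.left.bdd ψ‖ ^ 2 = N₁ at *
  generalize (c / 8 + C) / m = β at *
  have q₁ : c * (N₁ - 1 / 8 * ‖ψ‖ ^ 2) ≤ c * (N₁ - β * ‖ψ‖ ^ 2) :=
    mul_le_mul_of_nonneg_left (by linarith) hc.le
  have q₂ : c * (N₂ - 1 / 8 * ‖ψ‖ ^ 2) ≤ c * (N₂ - β * ‖ψ‖ ^ 2) :=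
    mul_le_mul_of_nonneg_left (by linarith) hc.le
  have q₃ : c * ‖ψ'‖ ^ 2 ≤ c * ‖ψ‖ ^ 2 :=
    mul_le_mul_of_nonneg_left q₀ hc.le
  have q₄ : e * ‖ψ‖ ^ 2 = e * N₁ + e * N₂ + e * N₃ := by rw [n₁, n₂]; ring
  have q₅ : c * ‖ψ‖ ^ 2 = c * N₁ + c * N₂ + c * N₃ := by rw [n₁, n₂]; ring
  linarith

/-! ### Atomic wells: integrability, and the choice of cutoffs and constants -/

namespace IsAtomicWell

variable {v : Plane → ℝ} {a : ℝ}

lemma isBddMeas (hv : IsAtomicWell v a) : IsBddMeas v := by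
  obtain ⟨M, hM⟩ := hv.bounded
  refine ⟨hv.measurable, M, fun x => ?_⟩
  rw [Real.norm_eq_abs, abs_of_nonpos (hv.nonpos x)]
  linarith [hM x]

lemma eq_zero_of_lt_norm (hv : IsAtomicWell v a) {x : Plane} (hx : a < ‖x‖) : v x = 0 := by
  by_contra h
  have := hv.support (subset_tsupport v h)
  rw [mem_closedBall_zero_iff] at this
  linarith

lemma integrable (hv : IsAtomicWell v a) : Integrable v := by
  obtain ⟨C, hC⟩ := hv.isBddMeas.bounded
  have h : IntegrableOn v (Metric.closedBall 0 a) :=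
    IntegrableOn.of_bound measure_closedBall_lt_top hv.measurable.aestronglyMeasurable C
      (Eventually.of_forall hC)
  refine (integrableOn_iff_integrable_of_support_subset ?_).1 h
  exact (subset_tsupport v).trans hv.support

end IsAtomicWell

/-- The energy estimate on the form domain. -/
theorem exists_energy_doubleWell_ge {v : Plane → ℝ} {a : ℝ} {d : Plane} (hv : IsAtomicWell v a)
    (hd : 2 * a < ‖d‖) :
    ∃ L C₁ C₂ : ℝ, 0 < L ∧ 0 < C₁ ∧ 0 < C₂ ∧ ∀ lam : ℝ, L < lam → ∀ (e : ℝ) (φ : L2),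
      IsGroundState (singleWell v lam) e φ → ∀ (ψ : L2) (g : L2Vec), HasMagGrad lam ψ g →
        inner ℂ φ ψ = (0 : ℂ) → inner ℂ (magTranslate lam d φ) ψ = (0 : ℂ) →
          C₁ * ‖ψ‖ ^ 2 + C₂ * (lam ^ 2)⁻¹ * ‖g‖ ^ 2
            ≤ energy (fun x => lam ^ 2 * (v x + v (x - d))) ψ g - e * ‖ψ‖ ^ 2 := by
  obtain ⟨c, hc, hgap⟩ := hv.gap
  obtain ⟨L₀, hgap⟩ := eventually_atTop.1 hgap
  have ha := hv.radius_pos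
  have hvb := hv.isBddMeas
  have hvd : IsBddMeas fun x => v (x - d) :=
    ⟨hvb.measurable.comp (measurable_id.sub_const d), by
      obtain ⟨C, hC⟩ := hvb.bounded
      exact ⟨C, fun x => hC _⟩⟩
  have hst : ∀ lam : ℝ, L₀ ≤ lam → ∀ (e : ℝ) (φ : L2), IsGroundState (singleWell v lam) e φ →
      IsGappedState lam (fun x => lam ^ 2 * v x) e c φ := fun lam hlam e φ h =>
    IsGappedState.of_isGroundState (hvb.const_mul _) h (hgap lam hlam e φ h)
  -- For an almost everywhere vanishing well no gapped ground state exists, so the claim is vacuous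
  -- and the constants are arbitrary.
  by_cases hv0 : v =ᵐ[volume] 0
  · refine ⟨max L₀ 1, 1, 1, by positivity, one_pos, one_pos, fun lam hlam e φ h => ?_⟩
    refine (not_isGroundState_of_ae_eq_zero (hvb.const_mul (lam ^ 2)) ?_ hc h
      (hgap lam ((le_max_left _ _).trans hlam.le) e φ h)).elim
    filter_upwards [hv0] with x hx
    rw [hx, Pi.zero_apply, mul_zero]
  have hneg : ∫ x, v x < 0 := by
    have h0 : ∫ x, v x ≤ 0 := integral_nonpos fun x => hv.nonpos x
    refine h0.lt_of_ne fun h1 => hv0 ?_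
    have h2 : ∫ x, -v x = 0 := by rw [integral_neg, h1, neg_zero]
    have h3 := (integral_eq_zero_iff_of_nonneg (fun x => neg_nonneg.2 (hv.nonpos x))
      hv.integrable.neg).1 h2
    filter_upwards [h3] with x hx
    have : -v x = 0 := hx
    exact neg_eq_zero.1 this
  obtain ⟨c', hc', L₁, hL₁, htrial⟩ := exists_energy_le ha hv.integrable hv.support hneg
  -- the cutoffs
  have hρ₁ : 0 < (a + ‖d‖ / 2) / 2 := by linarith
  have hρ₂ : (a + ‖d‖ / 2) / 2 < ‖d‖ / 2 := by linarith
  -- The inner radius is the midpoint of `a` and `‖d‖/2`, so it covers the well; the outer radius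
  -- `‖d‖/2` makes the two inner cutoffs disjoint.
  obtain ⟨χ₁, χ₁', hχ₁⟩ := exists_isCutoffPair 0 hρ₁ hρ₂
  obtain ⟨χ₂, χ₂', hχ₂⟩ := exists_isCutoffPair d hρ₁ hρ₂
  obtain ⟨D₁, hD₁, hD₁'⟩ := hχ₁.exists_gradSq_le (show 0 < c / 8 by linarith)
  obtain ⟨D₂, hD₂, hD₂'⟩ := hχ₂.exists_gradSq_le (show 0 < c / 8 by linarith)
  have hD : 0 ≤ max D₁ D₂ := le_max_of_le_left hD₁
  have hdisj : ∀ x, χ₁ x = 0 ∨ χ₂ x = 0 := by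
    intro x
    rcases le_or_gt (‖d‖ / 2) ‖x‖ with h | h
    · exact .inl (hχ₁.left_eq_zero x (by rwa [sub_zero]))
    · refine .inr (hχ₂.left_eq_zero x ?_)
      have := norm_sub_norm_le d x
      rw [norm_sub_rev] at this
      linarith
  have hvχ₁ : ∀ x, χ₁' x ≠ 0 → v x = 0 := fun x hx => hv.eq_zero_of_lt_norm <| by
    by_contra! h
    exact hx (hχ₁.right_eq_zero x (by rw [sub_zero]; linarith))
  have hvχ₂ : ∀ x, χ₂' x ≠ 0 → v (x - d) = 0 := fun x hx => hv.eq_zero_of_lt_norm <| by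
    by_contra! h
    exact hx (hχ₂.right_eq_zero x (by linarith))
  obtain ⟨M, hM⟩ := hv.bounded
  have hM0 : 0 ≤ M := by linarith [hM 0, hv.nonpos 0]
  -- `δ λ⁻²` will be the weight of the trivial bound, whose loss `2 M λ² ‖ψ‖²` then costs at most
  -- `c/8`.
  obtain ⟨δ, hδ0, hδ1, hδ2⟩ : ∃ δ : ℝ, 0 < δ ∧ δ ≤ 1 / 2 ∧ 2 * M * δ ≤ c / 8 := by
    refine ⟨min (1 / 2) (c / (16 * (M + 1))), lt_min (by norm_num) (by positivity),
      min_le_left _ _, ?_⟩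
    calc 2 * M * min (1 / 2) (c / (16 * (M + 1))) ≤ 2 * M * (c / (16 * (M + 1))) := by
          gcongr
          exact min_le_right _ _
      _ = c / 8 * (M / (M + 1)) := by field_simp; ring
      _ ≤ c / 8 * 1 := by
          gcongr
          rw [div_le_one (by linarith)]
          linarith
      _ = c / 8 := mul_one _
  set m := 2 * max D₁ D₂ + c + 8 * (c / 8 + max D₁ D₂) with hm
  have hm0 : 0 < m := by positivity
  refine ⟨max (max L₀ L₁) (max 1 (m / c')), c / 8, δ, by positivity, by positivity, hδ0,
    fun lam hlam e φ h ψ g hg hψ₁ hψ₂ => ?_⟩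
  obtain ⟨⟨hl₀, hl₁⟩, hl₂, hl₃⟩ : (L₀ < lam ∧ L₁ < lam) ∧ 1 < lam ∧ m / c' < lam := by
    simpa only [max_lt_iff] using hlam
  have hs := hst lam hl₀.le e φ h
  have hlam2 : 1 ≤ lam ^ 2 := by nlinarith
  -- The trial state forces `e ≤ -c' λ²`, and `λ > 1`, `λ > m/c'` turn this into the depth required.
  have he : m ≤ -e := by
    obtain ⟨u, gu, hu, hu0, hu'⟩ := htrial lam hl₁.le
    have h1 := (hs.le_energy hc.le hu).trans hu'
    have h2 : e ≤ -(c' * lam ^ 2) := le_of_mul_le_mul_right h1 (by positivity)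
    rw [div_lt_iff₀ hc'] at hl₃
    nlinarith
  have hs' := hs.magTranslate d
  have key := energy_ge_of_two_wells (hvb.const_mul (lam ^ 2)) (hvd.const_mul (lam ^ 2)) hs hs' hc
    hχ₁ hχ₂ (fun x hx => by rw [hvχ₁ x hx, mul_zero]) (fun x hx => by rw [hvχ₂ x hx, mul_zero])
    hdisj hD
    (fun x => (hD₁' x).trans (by gcongr; exact le_max_left _ _))
    (fun x => (hD₂' x).trans (by gcongr; exact le_max_right _ _))
    (show _ ≤ m by rw [hm]; linarith) (show _ ≤ m by rw [hm]; linarith) he hg hψ₁ hψ₂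
  simp only [← mul_add] at key
  have hbd : IsBddMeas fun x => lam ^ 2 * (v x + v (x - d)) := (hvb.add hvd).const_mul _
  have hlow : ‖g‖ ^ 2 - 2 * M * lam ^ 2 * ‖ψ‖ ^ 2
      ≤ energy (fun x => lam ^ 2 * (v x + v (x - d))) ψ g - e * ‖ψ‖ ^ 2 := by
    have h1 := integral_weight_mono (isBddMeas_const (-(2 * M * lam ^ 2))) hbd (fun x => by
      nlinarith [hM x, hM (x - d)]) ψ
    rw [integral_const_mul, ← norm_sq_eq_integral] at h1
    have h2 : e * ‖ψ‖ ^ 2 ≤ 0 := mul_nonpos_of_nonpos_of_nonneg (by linarith) (sq_nonneg _)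
    rw [energy]
    linarith
  generalize energy (fun x => lam ^ 2 * (v x + v (x - d))) ψ g - e * ‖ψ‖ ^ 2 = X at key hlow ⊢
  have hε0 : 0 < δ * (lam ^ 2)⁻¹ := by positivity
  have hε1 : δ * (lam ^ 2)⁻¹ ≤ 1 / 2 :=
    (mul_le_of_le_one_right hδ0.le (inv_le_one_of_one_le₀ hlam2)).trans hδ1
  -- Convex combination of the trivial bound and the gap bound: what remains is at least `(1/2)(c/2)
  -- - c/8 = c/8`.
  have k₁ := mul_le_mul_of_nonneg_left hlow hε0.le
  have k₂ := mul_le_mul_of_nonneg_left key (show 0 ≤ 1 - δ * (lam ^ 2)⁻¹ by linarith)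
  have k₃ : δ * (lam ^ 2)⁻¹ * (2 * M * lam ^ 2 * ‖ψ‖ ^ 2) = 2 * M * δ * ‖ψ‖ ^ 2 := by
    field_simp
  have k₄ : 2 * M * δ * ‖ψ‖ ^ 2 ≤ c / 8 * ‖ψ‖ ^ 2 := by gcongr
  have k₅ : 1 / 2 * (c / 2 * ‖ψ‖ ^ 2) ≤ (1 - δ * (lam ^ 2)⁻¹) * (c / 2 * ‖ψ‖ ^ 2) :=
    mul_le_mul_of_nonneg_right (by linarith) (by positivity)
  rw [mul_sub, k₃] at k₁
  linarith

/-! ### The compressed resolvent -/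

lemma re_inner_schrodinger_sub {b : ℝ} {W : Plane → ℝ} (hW : IsBddMeas W) {e : ℝ} (z : ℂ)
    (ψ : (schrodinger b W).domain) {g : L2Vec} (hg : HasMagGrad b ψ g) :
    (inner ℂ (ψ : L2) (schrodinger b W ψ - ((e : ℂ) + z) • (ψ : L2))).re
      = energy W ψ g - e * ‖(ψ : L2)‖ ^ 2 - z.re * ‖(ψ : L2)‖ ^ 2 := by
  obtain ⟨f, hf, hf'⟩ := schrodinger_apply hW ψ
  have h1 : (inner ℂ (ψ : L2) (ψ : L2) : ℂ) = ((‖(ψ : L2)‖ ^ 2 : ℝ) : ℂ) := by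
    rw [inner_self_eq_norm_sq_to_K]
    norm_cast
  rw [hf', inner_sub_right, hf.inner_self_eq hW hg, inner_smul_right, h1, energy, Complex.sub_re,
    Complex.ofReal_re, Complex.re_mul_ofReal, Complex.add_re, Complex.ofReal_re]
  ring

section Resolvent

variable {b : ℝ} {W : Plane → ℝ} {e C₁ C₂ : ℝ} {V : Submodule ℂ L2} [FiniteDimensional ℂ V] {z : ℂ}

/-- On `Vᗮ` the projection is invisible to the form, whose real part is at least `(C₁ - Re z)‖ψ‖²`;
Cauchy–Schwarz concludes. -/
lemma norm_le_compression (hW : IsBddMeas W) (hC₂ : 0 < C₂)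
    (hest : ∀ ψ ∈ Vᗮ, ∀ g, HasMagGrad b ψ g →
      C₁ * ‖ψ‖ ^ 2 + C₂ * ‖g‖ ^ 2 ≤ energy W ψ g - e * ‖ψ‖ ^ 2) (hz : ‖z‖ < C₁ / 2)
    (ψ : (compression (shift (schrodinger b W) (e + z)) Vᗮ).domain) :
    C₁ / 2 * ‖(ψ : Vᗮ)‖ ≤ ‖compression (shift (schrodinger b W) (e + z)) Vᗮ ψ‖ := by
  obtain ⟨⟨ψ, hψ⟩, hd⟩ := ψ
  let y : L2 := schrodinger b W ⟨ψ, hd⟩ - ((e : ℂ) + z) • ψ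
  change C₁ / 2 * ‖ψ‖ ≤ ‖Vᗮ.orthogonalProjectionOnto y‖
  have hg := hasMagGrad_magGrad b ⟨ψ, schrodinger_domain_le _ _ hd⟩
  have h1 := re_inner_schrodinger_sub (e := e) hW z ⟨ψ, hd⟩ hg
  have h2 := hest ψ hψ _ hg
  have h3 : inner ℂ ψ y = (inner ℂ (⟨ψ, hψ⟩ : Vᗮ) (Vᗮ.orthogonalProjectionOnto y) : ℂ) :=
    (Submodule.inner_orthogonalProjectionOnto_eq_of_mem_left ⟨ψ, hψ⟩ y).symm
  have h4 : (inner ℂ ψ y : ℂ).re ≤ ‖ψ‖ * ‖Vᗮ.orthogonalProjectionOnto y‖ := by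
    rw [h3]
    exact (Complex.re_le_norm _).trans (norm_inner_le_norm (𝕜 := ℂ) _ _)
  have h5 : (inner ℂ ψ y : ℂ).re = _ := h1
  have h6 : z.re * ‖ψ‖ ^ 2 ≤ C₁ / 2 * ‖ψ‖ ^ 2 :=
    mul_le_mul_of_nonneg_right ((Complex.re_le_norm z).trans hz.le) (sq_nonneg _)
  have h7 : 0 ≤ C₂ * ‖magGrad b ⟨ψ, schrodinger_domain_le _ _ hd⟩‖ ^ 2 := by positivity
  rcases (norm_nonneg ψ).eq_or_lt with h0 | h0
  · rw [← h0, mul_zero]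
    exact norm_nonneg _
  · refine le_of_mul_le_mul_left ?_ h0
    rw [h5] at h4
    simp only at h4
    linarith [show ‖ψ‖ * (C₁ / 2 * ‖ψ‖) = C₁ / 2 * ‖ψ‖ ^ 2 by ring]

/-- Lax–Milgram gives a solution tested only against `Vᗮ`. Since `V` lies in the operator domain,
testing against `V` is also `L²`-bounded, so the solution belongs to the operator domain; the extra
term lies in `V` and is projected away. -/
lemma compression_surjective (hW : IsBddMeas W) (hV : V ≤ (landau b).domain) (hC₂ : 0 < C₂)
    (hest : ∀ ψ ∈ Vᗮ, ∀ g, HasMagGrad b ψ g →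
      C₁ * ‖ψ‖ ^ 2 + C₂ * ‖g‖ ^ 2 ≤ energy W ψ g - e * ‖ψ‖ ^ 2) (hz : ‖z‖ < C₁ / 2) (f : Vᗮ) :
    ∃ ψ, compression (shift (schrodinger b W) (e + z)) Vᗮ ψ = f := by
  have hC₁ : 0 < C₁ := by linarith [norm_nonneg z]
  let B : L2 →L[ℂ] L2 := rmul W hW - ((e : ℂ) + z) • ContinuousLinearMap.id ℂ L2
  have hB : ∀ u, (inner ℂ u (B u)).re
      = (∫ x, W x * ‖u x‖ ^ 2) - e * ‖u‖ ^ 2 - z.re * ‖u‖ ^ 2 := by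
    intro u
    have h1 : (inner ℂ u u : ℂ) = ((‖u‖ ^ 2 : ℝ) : ℂ) := by
      rw [inner_self_eq_norm_sq_to_K]
      norm_cast
    change (inner ℂ u (rmul W hW u - ((e : ℂ) + z) • u)).re = _
    rw [inner_sub_right, inner_rmul_self, inner_smul_right, h1, Complex.sub_re, Complex.ofReal_re,
      Complex.re_mul_ofReal, Complex.add_re, Complex.ofReal_re]
    ring
  obtain ⟨ψ, hψ, g, hg, hweak⟩ := exists_weak_solution (b := b) V.isClosed_orthogonal B
    (C := min (C₁ / 2) C₂) (by positivity) (fun u g hu hg => by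
      have h1 := hest u hu g hg
      have h2 : z.re * ‖u‖ ^ 2 ≤ C₁ / 2 * ‖u‖ ^ 2 :=
        mul_le_mul_of_nonneg_right ((Complex.re_le_norm z).trans hz.le) (sq_nonneg _)
      have h3 := mul_le_mul_of_nonneg_right (min_le_left (C₁ / 2) C₂) (sq_nonneg ‖u‖)
      have h4 := mul_le_mul_of_nonneg_right (min_le_right (C₁ / 2) C₂) (sq_nonneg ‖g‖)
      rw [hB, mul_add]
      rw [energy] at h1
      linarith) f
  let LV : V →L[ℂ] L2 :=
    LinearMap.toContinuousLinearMap ((landau b).toFun ∘ₗ Submodule.inclusion hV)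
  -- `k` represents `w ↦ ⟨(P - b A x)² w, ψ⟩` on `V`, which is continuous because `V` is
  -- finite-dimensional.
  let k : V := ContinuousLinearMap.adjoint LV ψ
  have hk : ∀ w : V, ∀ gw, HasMagGrad b w gw → inner ℂ gw g = inner ℂ (w : L2) (k : L2) := by
    intro w gw hgw
    have h1 : HasLandau b w (LV w) := hasLandau_landau b ⟨w, hV w.2⟩
    have h2 : inner ℂ (w : L2) (k : L2) = inner ℂ w (ContinuousLinearMap.adjoint LV ψ) := rfl
    rw [h2, ContinuousLinearMap.adjoint_inner_right, ← inner_conj_symm, h1.inner_eq hgw hg,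
      inner_conj_symm]
  let P := Vᗮ.orthogonalProjectionOnto
  have hψL : HasLandau b ψ (P (f - B ψ) + k) := by
    refine ⟨g, hg, fun u gu hu => ?_⟩
    obtain ⟨w, hw, y, hy, rfl⟩ := V.exists_add_mem_mem_orthogonal u
    have hgw := hasLandau_landau b ⟨w, hV hw⟩
    obtain ⟨gw, hgw, -⟩ := hgw
    have hgy : HasMagGrad b y (gu + (-1 : ℂ) • gw) := by
      have := hu.add (hgw.smul (-1))
      simpa using this
    have h1 := hweak y hy _ hgy
    have h2 : inner ℂ gu g = inner ℂ gw g + inner ℂ (gu + (-1 : ℂ) • gw) g := by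
      rw [← inner_add_left]
      congr 1
      simp
    have h3 : inner ℂ y ((P (f - B ψ) : Vᗮ) : L2) = inner ℂ y (f - B ψ) :=
      Submodule.inner_orthogonalProjectionOnto_eq_of_mem_left (⟨y, hy⟩ : Vᗮ) _
    have h4 : inner ℂ w ((P (f - B ψ) : Vᗮ) : L2) = 0 :=
      (Submodule.mem_orthogonal _ _).1 (P (f - B ψ)).2 w hw
    have h5 : inner ℂ y (k : L2) = 0 := (Submodule.mem_orthogonal' _ _).1 hy _ k.2
    rw [h2, hk ⟨w, hw⟩ gw hgw, inner_add_right, inner_add_left w y, inner_add_left w y,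
      h3, h4, h5,
      inner_sub_right, ← h1]
    ring
  obtain ⟨hd, he⟩ := hψL.exists_schrodinger_eq hW
  refine ⟨⟨⟨ψ, hψ⟩, hd⟩, ?_⟩
  change P (schrodinger b W ⟨ψ, hd⟩ - ((e : ℂ) + z) • ψ) = f
  have h1 : schrodinger b W ⟨ψ, hd⟩ - ((e : ℂ) + z) • ψ
      = (P (f - B ψ) : Vᗮ) + (k : L2) + B ψ := by
    rw [he]
    change _ = _ + (rmul W hW ψ - ((e : ℂ) + z) • ψ)
    abel
  have h2 : P (k : L2) = 0 :=
    Submodule.orthogonalProjectionOnto_orthogonal_apply_eq_zero k.2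
  rw [h1, map_add, map_add, Submodule.orthogonalProjectionOnto_mem_subspace_eq_self, h2, add_zero,
    ← map_add, sub_add_cancel, Submodule.orthogonalProjectionOnto_mem_subspace_eq_self]

lemma exists_isBoundedInverse (hW : IsBddMeas W) (hV : V ≤ (landau b).domain) (hC₂ : 0 < C₂)
    (hest : ∀ ψ ∈ Vᗮ, ∀ g, HasMagGrad b ψ g →
      C₁ * ‖ψ‖ ^ 2 + C₂ * ‖g‖ ^ 2 ≤ energy W ψ g - e * ‖ψ‖ ^ 2) (hz : ‖z‖ < C₁ / 2) :
    ∃ R : Vᗮ →L[ℂ] Vᗮ, ‖R‖ ≤ 2 / C₁ ∧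
      IsBoundedInverse (compression (shift (schrodinger b W) (e + z)) Vᗮ) R := by
  have hC₁ : 0 < C₁ := by linarith [norm_nonneg z]
  set T := compression (shift (schrodinger b W) (e + z)) Vᗮ with hT
  have hbelow : ∀ ψ : T.domain, C₁ / 2 * ‖(ψ : Vᗮ)‖ ≤ ‖T ψ‖ := norm_le_compression hW hC₂ hest hz
  have hinj : Function.Injective T.toFun := by
    rw [injective_iff_map_eq_zero]
    intro ψ h0
    have h1 := hbelow ψ
    rw [show T ψ = 0 from h0, norm_zero] at h1
    have h2 : ‖(ψ : Vᗮ)‖ ≤ 0 := by nlinarith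
    exact Subtype.ext (norm_le_zero_iff.1 h2)
  let E := LinearEquiv.ofBijective T.toFun ⟨hinj, compression_surjective hW hV hC₂ hest hz⟩
  have hE : ∀ f, T (E.symm f) = f := fun f => E.apply_symm_apply f
  refine ⟨LinearMap.mkContinuous (T.domain.subtype ∘ₗ E.symm.toLinearMap) (2 / C₁) fun f => ?_,
    LinearMap.mkContinuous_norm_le _ (by positivity) _, fun f => ⟨(E.symm f).2, hE f⟩, fun ψ => ?_⟩
  · have h1 := hbelow (E.symm f)
    rw [hE] at h1
    change ‖((E.symm f : T.domain) : Vᗮ)‖ ≤ _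
    rw [div_mul_eq_mul_div, le_div_iff₀ hC₁]
    linarith
  · change ((E.symm (E ψ) : T.domain) : Vᗮ) = ψ
    rw [E.symm_apply_apply]

end Resolvent

lemma HasLandau.mem_domain {b : ℝ} {ψ f : L2} (h : HasLandau b ψ f) : ψ ∈ (landau b).domain :=
  h.exists_landau_eq.1

lemma mem_orbitalSpace_orthogonal {lam : ℝ} {d : Plane} {φ ψ : L2}
    (h : ψ ∈ (orbitalSpace lam d φ)ᗮ) :
    inner ℂ φ ψ = (0 : ℂ) ∧ inner ℂ (magTranslate lam d φ) ψ = (0 : ℂ) :=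
  ⟨(Submodule.mem_orthogonal _ _).1 h _ (Submodule.subset_span (by simp)),
    (Submodule.mem_orthogonal _ _).1 h _ (Submodule.subset_span (by simp))⟩

end

end MagneticDoubleWell

/-! ### The theorem -/

open MagneticDoubleWell in
theorem theoremB1 (v : Plane → ℝ) (a : ℝ) (d : Plane) (hv : IsAtomicWell v a)
    (hd : 2 * a < ‖d‖) :
    ∃ lamStar C₁ C₂ r K : ℝ, 0 < lamStar ∧ 0 < C₁ ∧ 0 < C₂ ∧ 0 < r ∧ 0 < K ∧
      ∀ lam : ℝ, lamStar < lam → ∀ (e₀ : ℝ) (φ₀ : L2), IsGroundState (singleWell v lam) e₀ φ₀ →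
        -- the energy estimate on the operator domain of `H^λ`
        (∀ ψ : (doubleWell v d lam).domain,
          inner ℂ φ₀ (ψ : L2) = 0 → inner ℂ (magTranslate lam d φ₀) (ψ : L2) = 0 →
            C₁ * ‖ψ‖ ^ 2
                + C₂ * (lam ^ 2)⁻¹ * ‖magGrad lam ⟨ψ, schrodinger_domain_le _ _ ψ.2⟩‖ ^ 2
              ≤ (inner ℂ (ψ : L2) (shift (doubleWell v d lam) e₀ ψ)).re) ∧
        -- the energy estimate on the form domain of `H^λ`
        (∀ ψ : (magGrad lam).domain,
          inner ℂ φ₀ (ψ : L2) = 0 → inner ℂ (magTranslate lam d φ₀) (ψ : L2) = 0 →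
            C₁ * ‖ψ‖ ^ 2 + C₂ * (lam ^ 2)⁻¹ * ‖magGrad lam ψ‖ ^ 2
              ≤ ‖magGrad lam ψ‖ ^ 2
                + ∫ x, (lam ^ 2 * (v x + v (x - d)) - e₀) * ‖(ψ : L2) x‖ ^ 2) ∧
        -- the resolvent bound on the orthogonal complement of the orbital subspace
        (∀ z : ℂ, ‖z‖ < r →
          ∃ R : (orbitalSpace lam d φ₀)ᗮ →L[ℂ] (orbitalSpace lam d φ₀)ᗮ, ‖R‖ ≤ K ∧
            IsBoundedInverse
              (compression (shift (doubleWell v d lam) (e₀ + z)) (orbitalSpace lam d φ₀)ᗮ) R) := by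

  have hvb := hv.isBddMeas
  have hvd : IsBddMeas fun x => v (x - d) :=
    ⟨hvb.measurable.comp (measurable_id.sub_const d), by
      obtain ⟨C, hC⟩ := hvb.bounded
      exact ⟨C, fun x => hC _⟩⟩
  obtain ⟨L, C₁, C₂, hL, hC₁, hC₂, h⟩ := exists_energy_doubleWell_ge hv hd
  refine ⟨L, C₁, C₂, C₁ / 2, 2 / C₁, hL, hC₁, hC₂, by positivity, by positivity,
    fun lam hlam e φ hφ => ?_⟩
  have hW : IsBddMeas fun x => lam ^ 2 * (v x + v (x - d)) := (hvb.add hvd).const_mul _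
  have hlam0 : 0 < lam := hL.trans hlam
  have hest := h lam hlam e φ hφ
  refine ⟨fun ψ h₁ h₂ => ?_, fun ψ h₁ h₂ => ?_, fun z hz => ?_⟩
  · have hg := hasMagGrad_magGrad lam ⟨(ψ : L2), schrodinger_domain_le _ _ ψ.2⟩
    refine (hest _ _ hg h₁ h₂).trans (le_of_eq ?_)
    have h3 := re_inner_schrodinger_sub (e := e) hW 0 ψ hg
    rw [add_zero, Complex.zero_re, zero_mul, sub_zero] at h3
    exact h3.symm
  · refine (hest _ _ (hasMagGrad_magGrad lam ψ) h₁ h₂).trans (le_of_eq ?_)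
    rw [energy, add_sub_assoc, norm_sq_eq_integral (ψ : L2), ← integral_const_mul,
      ← integral_sub (hW.integrable_mul_norm_sq ψ) ((integrable_norm_sq _).const_mul _)]
    simp only [sub_mul]
  · have : FiniteDimensional ℂ (orbitalSpace lam d φ) :=
      FiniteDimensional.span_of_finite ℂ (Set.toFinite _)
    obtain ⟨f, hf, -⟩ := hφ.exists_hasLandau (hvb.const_mul (lam ^ 2))
    -- The kinetic coefficient depends on `λ`, but the inverse bound `2 / C₁` does not involve it;
    -- only its positivity is needed.
    refine exists_isBoundedInverse hW ?_ (C₂ := C₂ * (lam ^ 2)⁻¹) (by positivity)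
      (fun ψ hψ g hg => ?_) hz
    · refine Submodule.span_le.2 (Set.insert_subset hf.mem_domain ?_)
      exact Set.singleton_subset_iff.2 (hf.magTranslate d).mem_domain
    · obtain ⟨h₁, h₂⟩ := mem_orbitalSpace_orthogonal hψ
      exact hest ψ g hg h₁ h₂
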